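/- **Setting.** All manifolds are smooth, finite-dimensional, Hausdorff and second countable, and all maps, forms and vector fields are smooth. Let $\pi\colon E\to M$ be a fibred manifold (a surjective submersion) with $\dim M=m$, $\dim E=m+n$, and let $\eta$ be a volume form on $M$. Let $\pi^1\colon J^1\pi\to E$ be the first jet bundle, whose points over $u\in E$ are the linear right inverses $T_x\phi$ of $T_u\pi$ ($\phi$ a local section with $\phi(x)=u$), and put $\bar\pi^1=\pi\circ\pi^1$. Let $\Lambda^m_k(T^*E)$ be the bundle of $m$-covectors on $E$ that vanish when contracted with $k$ $\pi$-vertical vectors, let $J^1\pi^*=\Lambda^m_2(T^*E)/\Lambda^m_1(T^*E)$ with projections $\pi_E^r\colon J^1\pi^*\to E$, $\bar\pi_E^r=\pi\circ\pi_E^r$, and let $\mu\colon\Lambda^m_2(T^*E)\to J^1\pi^*$ be the quotient map. Sections are local sections, defined on open subsets of the base, except that $\Psi$, $s$, $h$ below are global. For a fibred manifold $\rho\colon P\to M$, a distribution $\mathcal D$ on $P$ is a subbundle of $TP$; it is $m$-dimensional if it has rank $m$, $\rho$-transverse if $\mathcal D_p\cap\ker T_p\rho=0$ for all $p$, and integrable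 if an $m$-dimensional integral manifold passes through every point. A section $\psi\colon U\to P$ of $\rho$ is an integral section of $\mathcal D$ if $\operatorname{Im}T_x\psi=\mathcal D_{\psi(x)}$ for all $x\in U$. The class $\{\mathcal X\}$ associated with $\mathcal D$ consists of the non-vanishing, locally decomposable $m$-multivector fields on $P$ that are sections of $\Lambda^m\mathcal D$. Let $\mathcal D$ be an $m$-dimensional, integrable and $\pi$-transverse distribution on $E$, with associated class $\{\mathcal X\}$. **Lagrangian part.** Let $L\in C^\infty(J^1\pi)$, let $\Theta_{\mathcal L}$ be the Cartan $m$-form of the Lagrangian density $\mathcal L=L\,(\bar\pi^1)^*\eta$, given in natural coordinates with $\eta=d^mx$ by $$\Theta_{\mathcal L}=\frac{\partial L}{\partial u^\alpha_i}\,(du^\alpha-u^\alpha_j\,dx^j)\wedge d^{m-1}x_i+L\,d^mx ,\qquad d^{m-1}x_i=i(\partial/\partial x^i)\,d^mx ,$$ and let $\Omega_{\mathcal L}=-d\Theta_{\mathcal L}$. Let $\mathcal D_{\mathcal L}$ be an $m$-dimensional, $\bar\pi^1$-transverse and integrable distribution on $J^1\pi$ whose integral sections are all prolongations $j^1\phi$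 of sections $\phi$ of $\pi$ satisfying $(j^1\phi)^*i(X)\Omega_{\mathcal L}=0$ for every vector field $X$ on $J^1\pi$, and let $\{\mathcal X_{\mathcal L}\}$ be its associated class. Let $\Psi$ be a section of $\pi^1$ (a jet field) such that, for every section $\gamma$ of $\pi$, $$\gamma\text{ is an integral section of }\mathcal D\ \Longrightarrow\ \Psi\circ\gamma\text{ is an integral section of }\mathcal D_{\mathcal L}.$$ Then for every $\mathcal X\in\{\mathcal X\}$ there is $\mathcal X_{\mathcal L}\in\{\mathcal X_{\mathcal L}\}$, satisfying $i(\mathcal X_{\mathcal L})\Omega_{\mathcal L}=0$, with $$\mathcal X=\Lambda^mT\pi^1\circ\mathcal X_{\mathcal L}\circ\Psi .$$ Moreover $\mathcal D_u=T_{\Psi(u)}\pi^1\big((\mathcal D_{\mathcal L})_{\Psi(u)}\big)$ for every $u\in E$; so $\mathcal D$ is determined by $\Psi$ and $\mathcal D_{\mathcal L}$. **Hamiltonian part.** Let $\Theta$ be the Liouville $m$-form on $\Lambda^m_2(T^*E)$ (at $(u,\beta)$ it is the pullback of $\beta$ along the projection to $E$), $\Omega=-d\Theta$, let $h$ be a section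 of $\mu$ and $\Omega_h=h^*\Omega$. Let $\mathcal D_h$ be an $m$-dimensional, $\bar\pi_E^r$-transverse and integrable distribution on $J^1\pi^*$ whose integral sections $\psi$ all satisfy $\psi^*i(X)\Omega_h=0$ for every vector field $X$ on $J^1\pi^*$, and let $\{\mathcal X_h\}$ be its associated class. Let $s$ be a section of $\pi_E^r$ such that, for every section $\gamma$ of $\pi$, $$\gamma\text{ is an integral section of }\mathcal D\ \Longrightarrow\ s\circ\gamma\text{ is an integral section of }\mathcal D_h.$$ Then for every $\mathcal X\in\{\mathcal X\}$ there is $\mathcal X_h\in\{\mathcal X_h\}$, satisfying $i(\mathcal X_h)\Omega_h=0$, with $$\mathcal X=\Lambda^mT\pi_E^r\circ\mathcal X_h\circ s ,$$ and $\mathcal D_u=T_{s(u)}\pi_E^r\big((\mathcal D_h)_{s(u)}\big)$ for every $u\in E$. -/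

import Mathlib

open scoped Manifold ContDiff

noncomputable section

open Set Function
open scoped Topology

namespace FieldHJ

/-- The model space `ℝᵏ`. -/
abbrev Euc (k : ℕ) : Type := EuclideanSpace ℝ (Fin k)

/-! ### Calculus lemmas for the smooth structures below -/

instance finiteDimensional_alternating {V : Type*} [NormedAddCommGroup V] [NormedSpace ℝ V]
    [FiniteDimensional ℝ V] (k : ℕ) : FiniteDimensional ℝ (V [⋀^Fin k]→L[ℝ] ℝ) := by
  let f : (V [⋀^Fin k]→L[ℝ] ℝ) →ₗ[ℝ] MultilinearMap ℝ (fun _ : Fin k => V) ℝ :=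
    { toFun := fun g => g.toContinuousMultilinearMap.toMultilinearMap
      map_add' := fun _ _ => rfl
      map_smul' := fun _ _ => rfl }
  refine FiniteDimensional.of_injective f fun a b h => ?_
  ext v
  exact congrArg (fun g : MultilinearMap ℝ (fun _ : Fin k => V) ℝ => g v) h

theorem contDiffOn_of_injective {X A B : Type*} [NormedAddCommGroup X] [NormedSpace ℝ X]
    [NormedAddCommGroup A] [NormedSpace ℝ A] [FiniteDimensional ℝ A]
    [NormedAddCommGroup B] [NormedSpace ℝ B]
    (ι : A →L[ℝ] B) (hι : Injective ι) {f : X → A} {s : Set X}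
    (h : ContDiffOn ℝ ∞ (fun x => ι (f x)) s) : ContDiffOn ℝ ∞ f s := by
  obtain ⟨r, hr⟩ := ι.toLinearMap.exists_leftInverse_of_injective (LinearMap.ker_eq_bot.2 hι)
  obtain ⟨P, hP⟩ := Submodule.ClosedComplemented.of_finiteDimensional (LinearMap.range ι.toLinearMap)
  let r' : LinearMap.range ι.toLinearMap →L[ℝ] A :=
    LinearMap.toContinuousLinearMap (r ∘ₗ (LinearMap.range ι.toLinearMap).subtype)
  have key : ∀ a, (r' ∘L P) (ι a) = a := fun a => by
    have h1 := hP ⟨ι a, ⟨a, rfl⟩⟩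
    simp only [ContinuousLinearMap.comp_apply]
    erw [h1]
    exact LinearMap.congr_fun hr a
  exact ((r' ∘L P).contDiff.comp_contDiffOn h).congr fun x _ => (key (f x)).symm

theorem contDiff_compContinuousLinearMap {V V' : Type*}
    [NormedAddCommGroup V] [NormedSpace ℝ V] [FiniteDimensional ℝ V]
    [NormedAddCommGroup V'] [NormedSpace ℝ V'] [FiniteDimensional ℝ V'] (k : ℕ) :
    ContDiff ℝ ∞ (fun p : (V' [⋀^Fin k]→L[ℝ] ℝ) × (V →L[ℝ] V') =>
      p.1.compContinuousLinearMap p.2) := by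
  rw [← contDiffOn_univ]
  refine contDiffOn_of_injective
    (ContinuousAlternatingMap.toContinuousMultilinearMapCLM ℝ)
    (fun a b h => ContinuousAlternatingMap.toContinuousMultilinearMap_injective h) ?_
  rw [contDiffOn_univ]
  have h1 : ContDiff ℝ ∞ (fun p : (V' [⋀^Fin k]→L[ℝ] ℝ) × (V →L[ℝ] V') =>
      ContinuousMultilinearMap.compContinuousLinearMapContinuousMultilinear ℝ
        (fun _ : Fin k => V) (fun _ => V') ℝ (fun _ => p.2)) :=
    (ContinuousMultilinearMap.contDiff _).comp (contDiff_pi.2 fun _ => contDiff_snd)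
  have h2 : ContDiff ℝ ∞ (fun p : (V' [⋀^Fin k]→L[ℝ] ℝ) × (V →L[ℝ] V') =>
      p.1.toContinuousMultilinearMap) :=
    (ContinuousAlternatingMap.toContinuousMultilinearMapCLM (𝕜 := ℝ) (E := V') (F := ℝ) (ι := Fin k)
      ℝ).contDiff.comp contDiff_fst
  exact h1.clm_apply h2

theorem contDiff_coe_snd {A X : Type*} [NormedAddCommGroup A] [NormedSpace ℝ A]
    [NormedAddCommGroup X] [NormedSpace ℝ X] (S : Submodule ℝ A) :
    ContDiff ℝ ∞ (fun q : X × S => (q.2 : A)) :=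
  S.subtypeL.contDiff.comp (contDiff_snd : ContDiff ℝ ∞ (Prod.snd : X × S → S))

/-- A linear projection of a finite-dimensional space onto a subspace. -/
def subspaceProj {A : Type*} [NormedAddCommGroup A] [NormedSpace ℝ A] [FiniteDimensional ℝ A]
    (S : Submodule ℝ A) (x : A) : S :=
  (Submodule.ClosedComplemented.of_finiteDimensional S).choose x

theorem contDiff_subspaceProj {A : Type*} [NormedAddCommGroup A] [NormedSpace ℝ A]
    [FiniteDimensional ℝ A] (S : Submodule ℝ A) : ContDiff ℝ ∞ (subspaceProj S) :=
  (Submodule.ClosedComplemented.of_finiteDimensional S).choose.contDiff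

theorem subspaceProj_coe {A : Type*} [NormedAddCommGroup A] [NormedSpace ℝ A]
    [FiniteDimensional ℝ A] (S : Submodule ℝ A) (x : S) : subspaceProj S x = x :=
  (Submodule.ClosedComplemented.of_finiteDimensional S).choose_spec x

theorem contDiffOn_pullback {V : Type*} [NormedAddCommGroup V] [NormedSpace ℝ V]
    [FiniteDimensional ℝ V] {k : ℕ} (S : Submodule ℝ (V [⋀^Fin k]→L[ℝ] ℝ)) {T : V → V →L[ℝ] V}
    {s : Set V} (hT : ContDiffOn ℝ ∞ T s) :
    ContDiffOn ℝ ∞ (fun q : V × S => (q.2 : V [⋀^Fin k]→L[ℝ] ℝ).compContinuousLinearMap (T q.1))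
      (s ×ˢ univ) := by
  have h2 : ContDiffOn ℝ ∞ (fun q : V × S => T q.1) (s ×ˢ univ) :=
    hT.comp contDiffOn_fst fun q hq => hq.1
  exact (contDiff_compContinuousLinearMap k).comp_contDiffOn
    ((contDiff_coe_snd S).contDiffOn.prodMk h2)

theorem contDiffOn_proj_pullback {V : Type*} [NormedAddCommGroup V] [NormedSpace ℝ V]
    [FiniteDimensional ℝ V] {k : ℕ} (S : Submodule ℝ (V [⋀^Fin k]→L[ℝ] ℝ)) {T : V → V →L[ℝ] V}
    {s : Set V} (hT : ContDiffOn ℝ ∞ T s) :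
    ContDiffOn ℝ ∞ (fun q : V × S =>
      subspaceProj S ((q.2 : V [⋀^Fin k]→L[ℝ] ℝ).compContinuousLinearMap (T q.1)))
      (s ×ˢ univ) :=
  (contDiff_subspaceProj S).comp_contDiffOn (contDiffOn_pullback S hT)

theorem contDiffOn_proj_pullback_sub {V : Type*} [NormedAddCommGroup V] [NormedSpace ℝ V]
    [FiniteDimensional ℝ V] {k : ℕ} (S : Submodule ℝ (V [⋀^Fin k]→L[ℝ] ℝ)) {T : V → V →L[ℝ] V}
    (P : V →L[ℝ] V) {s : Set V} (hT : ContDiffOn ℝ ∞ T s) :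
    ContDiffOn ℝ ∞ (fun q : V × S =>
      subspaceProj S ((q.2 : V [⋀^Fin k]→L[ℝ] ℝ).compContinuousLinearMap (T q.1) -
        ((q.2 : V [⋀^Fin k]→L[ℝ] ℝ).compContinuousLinearMap (T q.1)).compContinuousLinearMap P))
      (s ×ˢ univ) :=
  (contDiff_subspaceProj S).comp_contDiffOn ((contDiffOn_pullback S hT).sub
    ((contDiff_compContinuousLinearMap k).comp_contDiffOn
      ((contDiffOn_pullback S hT).prodMk contDiffOn_const)))

/-! ### Smooth structure on a family of fibres, glued from local trivialisations -/

/-- Local trivialisations of a family of sets `Z u`, `u : B`, with typical fibre `W`: for every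
`i : B` a chart `base i` of `B` around `i` and bijections `Z u ≃ W` for `u` in its domain,
with smooth changes of coordinates. -/
structure FibreCharts {B : Type*} [TopologicalSpace B] (V W : Type*) [NormedAddCommGroup V]
    [NormedSpace ℝ V] [NormedAddCommGroup W] [NormedSpace ℝ W] (Z : B → Type*) where
  base : B → OpenPartialHomeomorph B V
  mem_base : ∀ u, u ∈ (base u).source
  fib : ∀ i u, u ∈ (base i).source → (Z u ≃ W)
  smooth_base : ∀ i j, ContDiffOn ℝ ∞ (base j ∘ (base i).symm) ((base i).symm.trans (base j)).source
  smooth_fib : ∀ i j, ∃ g : V × W → W,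
    ContDiffOn ℝ ∞ g (((base i).symm.trans (base j)).source ×ˢ univ) ∧
    ∀ u (hi : u ∈ (base i).source) (hj : u ∈ (base j).source) (a : Z u),
      fib j u hj a = g (base i u, fib i u hi a)

namespace FibreCharts

variable {B : Type*} [TopologicalSpace B] {V W : Type*} [NormedAddCommGroup V]
  [NormedSpace ℝ V] [NormedAddCommGroup W] [NormedSpace ℝ W] {Z : B → Type*}
  (c : FibreCharts V W Z)

open Classical in
/-- The chart `(u, a) ↦ (base i u, fib i u a)` on the total space. -/
def chartFun (i : B) (p : Bundle.TotalSpace W Z) : V × W :=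
  if h : p.proj ∈ (c.base i).source then (c.base i p.proj, c.fib i p.proj h p.snd)
  else (c.base i p.proj, 0)

open Classical in
/-- The inverse of the chart `chartFun`. -/
def chartInv (i : B) (q : V × W) : Bundle.TotalSpace W Z :=
  if h : q.1 ∈ (c.base i).target then
    ⟨(c.base i).symm q.1, (c.fib i _ ((c.base i).map_target h)).symm q.2⟩
  else ⟨i, (c.fib i i (c.mem_base i)).symm 0⟩

theorem chartFun_mk (i : B) {u : B} (a : Z u) (h : u ∈ (c.base i).source) :
    c.chartFun i ⟨u, a⟩ = (c.base i u, c.fib i u h a) := dif_pos h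

theorem chartInv_mk (i : B) {z : V} (w : W) (h : z ∈ (c.base i).target) :
    c.chartInv i (z, w) = ⟨(c.base i).symm z, (c.fib i _ ((c.base i).map_target h)).symm w⟩ :=
  dif_pos h

/-- The chart of the total space over the domain of `base i`. -/
def chart (i : B) : PartialEquiv (Bundle.TotalSpace W Z) (V × W) where
  toFun := c.chartFun i
  invFun := c.chartInv i
  source := Bundle.TotalSpace.proj ⁻¹' (c.base i).source
  target := (c.base i).target ×ˢ univ
  map_source' := by
    rintro ⟨u, a⟩ (hp : u ∈ (c.base i).source)
    rw [chartFun_mk c i a hp]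
    exact ⟨(c.base i).map_source hp, trivial⟩
  map_target' := by
    rintro ⟨z, w⟩ ⟨hz, -⟩
    rw [chartInv_mk c i w hz]
    exact (c.base i).map_target hz
  left_inv' := by
    rintro ⟨u, a⟩ (hp : u ∈ (c.base i).source)
    rw [chartFun_mk c i a hp, chartInv_mk c i _ ((c.base i).map_source hp)]
    have hu := (c.base i).left_inv hp
    generalize_proofs h1
    revert h1
    rw [hu]
    intro h1
    simp
  right_inv' := by
    rintro ⟨z, w⟩ ⟨hz, -⟩
    rw [chartInv_mk c i w hz, chartFun_mk c i _ ((c.base i).map_target hz)]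
    simp [(c.base i).right_inv hz]

theorem chart_apply (i : B) {u : B} (a : Z u) (h : u ∈ (c.base i).source) :
    c.chart i ⟨u, a⟩ = (c.base i u, c.fib i u h a) := dif_pos h

theorem chart_symm_apply (i : B) {z : V} (w : W) (h : z ∈ (c.base i).target) :
    (c.chart i).symm (z, w) =
      ⟨(c.base i).symm z, (c.fib i _ ((c.base i).map_target h)).symm w⟩ := dif_pos h

theorem chart_trans_source (i j : B) : ((c.chart i).symm.trans (c.chart j)).source =
    ((c.base i).symm.trans (c.base j)).source ×ˢ univ := by
  ext ⟨z, w⟩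
  constructor
  · rintro ⟨⟨h1, -⟩, h2⟩
    have h1 : z ∈ (c.base i).target := h1
    have h2 : (c.chart i).symm (z, w) ∈ (c.chart j).source := h2
    rw [c.chart_symm_apply i w h1] at h2
    exact ⟨⟨h1, h2⟩, trivial⟩
  · rintro ⟨⟨h1, h2⟩, -⟩
    have h1 : z ∈ (c.base i).target := h1
    refine ⟨⟨h1, trivial⟩, ?_⟩
    change (c.chart i).symm (z, w) ∈ (c.chart j).source
    rw [c.chart_symm_apply i w h1]
    exact h2

theorem contDiffOn_chart_trans (i j : B) : ContDiffOn ℝ ∞ ((c.chart i).symm.trans (c.chart j))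
    ((c.chart i).symm.trans (c.chart j)).source := by
  rw [chart_trans_source]
  obtain ⟨g, hg, hgj⟩ := c.smooth_fib i j
  refine ContDiffOn.congr (f := fun q : V × W => ((c.base j ∘ (c.base i).symm) q.1, g q))
    (((c.smooth_base i j).comp contDiffOn_fst fun q hq => hq.1).prodMk hg) ?_
  rintro ⟨z, w⟩ ⟨⟨hz, hz'⟩, -⟩
  have hz : z ∈ (c.base i).target := hz
  have hz' : (c.base i).symm z ∈ (c.base j).source := hz'
  change c.chart j ((c.chart i).symm (z, w)) = _
  rw [c.chart_symm_apply i w hz, c.chart_apply j _ hz']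
  simp [hgj _ ((c.base i).map_target hz), (c.base i).right_inv hz]

/-- The charts `chart i` make the total space a manifold modelled on `V × W`. -/
def core : ChartedSpaceCore (V × W) (Bundle.TotalSpace W Z) where
  atlas := range c.chart
  chartAt p := c.chart p.proj
  mem_chart_source p := c.mem_base p.proj
  chart_mem_atlas p := ⟨_, rfl⟩
  open_source := by
    rintro _ _ ⟨i, rfl⟩ ⟨j, rfl⟩
    rw [chart_trans_source]
    exact (OpenPartialHomeomorph.open_source _).prod isOpen_univ
  continuousOn_toFun := by
    rintro _ _ ⟨i, rfl⟩ ⟨j, rfl⟩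
    exact (c.contDiffOn_chart_trans i j).continuousOn

theorem isManifold : let _ := c.core.toTopologicalSpace
    let _ := c.core.toChartedSpace
    IsManifold 𝓘(ℝ, V × W) ∞ (Bundle.TotalSpace W Z) := by
  let _ := c.core.toTopologicalSpace
  let _ := c.core.toChartedSpace
  refine isManifold_of_contDiffOn _ _ _ ?_
  rintro e e' he he'
  obtain ⟨_, ⟨_, rfl⟩, _, ⟨⟨i, rfl⟩, rfl⟩, he⟩ := he
  obtain ⟨_, ⟨_, rfl⟩, _, ⟨⟨j, rfl⟩, rfl⟩, he'⟩ := he'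
  rw [mem_singleton_iff] at he he'
  subst he he'
  have := c.contDiffOn_chart_trans i j
  simp only [modelWithCornersSelf_coe, modelWithCornersSelf_coe_symm, range_id, preimage_id,
    inter_univ]
  exact this

end FibreCharts

/-! ### Linear algebra of the fibres -/

section Linear

variable {X Y : Type*} [AddCommGroup X] [Module ℝ X] [TopologicalSpace X]
  [AddCommGroup Y] [Module ℝ Y] [TopologicalSpace Y]
  {V₁ V₂ : Type*} [NormedAddCommGroup V₁] [NormedSpace ℝ V₁]
  [NormedAddCommGroup V₂] [NormedSpace ℝ V₂]

/-- The `k`-forms on `X` that vanish whenever `r` of their arguments lie in the kernel of `p`. -/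
def semibasic (p : X →L[ℝ] Y) (r k : ℕ) : Submodule ℝ (X [⋀^Fin k]→L[ℝ] ℝ) where
  carrier := {β | ∀ (v : Fin k → X) (s : Finset (Fin k)), s.card = r → (∀ i ∈ s, p (v i) = 0) →
    β v = 0}
  add_mem' := fun ha hb v s hs hv => by
    simp [ha v s hs hv, hb v s hs hv]
  zero_mem' := fun v s hs hv => by simp
  smul_mem' := fun c a ha v s hs hv => by simp [ha v s hs hv]

variable {p : X →L[ℝ] Y} {k : ℕ}

/-- In linear coordinates adapted to `p`, right inverses of `p` are graphs of linear maps. -/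
def sectionEquiv (a : X ≃L[ℝ] V₁ × V₂) (b : Y ≃L[ℝ] V₁) (h : ∀ x, (a x).1 = b (p x)) :
    {A : Y →L[ℝ] X // p.comp A = ContinuousLinearMap.id ℝ Y} ≃ (V₁ →L[ℝ] V₂) where
  toFun A := (ContinuousLinearMap.snd ℝ V₁ V₂).comp
    ((a : X →L[ℝ] V₁ × V₂).comp (A.1.comp (b.symm : V₁ →L[ℝ] Y)))
  invFun B := ⟨(a.symm : V₁ × V₂ →L[ℝ] X).comp
      (((ContinuousLinearMap.id ℝ V₁).prod B).comp (b : Y →L[ℝ] V₁)), by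
    ext y
    apply b.injective
    simp [← h]⟩
  left_inv A := by
    ext y
    apply a.injective
    have h1 : p (A.1 y) = y := DFunLike.congr_fun A.2 y
    ext1
    · simp [h, h1]
    · simp
  right_inv B := by
    ext v
    simp

theorem sectionEquiv_change (a a' : X ≃L[ℝ] V₁ × V₂) (b b' : Y ≃L[ℝ] V₁)
    (h : ∀ x, (a x).1 = b (p x)) (h' : ∀ x, (a' x).1 = b' (p x))
    (T T' : V₁ × V₂ →L[ℝ] V₁ × V₂) (hT : ∀ x, T (a x) = a' x) (hT' : ∀ x, T' (a' x) = a x)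
    (A : {A : Y →L[ℝ] X // p.comp A = ContinuousLinearMap.id ℝ Y}) :
    sectionEquiv a' b' h' A = (ContinuousLinearMap.snd ℝ V₁ V₂).comp (T.comp
      (((ContinuousLinearMap.id ℝ V₁).prod (sectionEquiv a b h A)).comp
        ((ContinuousLinearMap.fst ℝ V₁ V₂).comp (T'.comp (ContinuousLinearMap.inl ℝ V₁ V₂))))) := by
  ext v
  obtain ⟨y, rfl⟩ := b'.surjective v
  have hA : ∀ y, p (A.1 y) = y := fun y => DFunLike.congr_fun A.2 y
  have h1 : (T' (b' y, 0)).1 = b y := by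
    obtain ⟨x, hx⟩ := a'.surjective (b' y, 0)
    have hx1 : b' (p x) = b' y := by rw [← h', hx]
    rw [← hx, hT', h, b'.injective hx1]
  have h2 : a (A.1 y) = (b y, (a (A.1 y)).2) := by
    ext1
    · simp [h, hA]
    · rfl
  simp [sectionEquiv, h1, ← h2, hT]

theorem comp_mem_semibasic {X' Y' : Type*} [AddCommGroup X'] [Module ℝ X'] [TopologicalSpace X']
    [AddCommGroup Y'] [Module ℝ Y'] [TopologicalSpace Y'] {p' : X' →L[ℝ] Y'} (T : X' →L[ℝ] X)
    (hT : ∀ x, p' x = 0 → p (T x) = 0) {r k : ℕ} {β : X [⋀^Fin k]→L[ℝ] ℝ}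
    (hβ : β ∈ semibasic p r k) : β.compContinuousLinearMap T ∈ semibasic p' r k :=
  fun v s hs hv => hβ (T ∘ v) s hs fun i hi => hT _ (hv i hi)

/-- Semibasic forms in linear coordinates adapted to `p`. -/
def semibasicEquiv (a : X ≃L[ℝ] V₁ × V₂) (b : Y ≃L[ℝ] V₁) (h : ∀ x, (a x).1 = b (p x)) (r k : ℕ) :
    semibasic p r k ≃ₗ[ℝ] semibasic (ContinuousLinearMap.fst ℝ V₁ V₂) r k where
  toFun β := ⟨β.1.compContinuousLinearMap (a.symm : V₁ × V₂ →L[ℝ] X),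
    comp_mem_semibasic _ (fun x hx => by
      apply b.injective
      rw [map_zero, ← h]
      simpa using hx) β.2⟩
  invFun β := ⟨β.1.compContinuousLinearMap (a : X →L[ℝ] V₁ × V₂),
    comp_mem_semibasic _ (fun x hx => by simp [h, hx]) β.2⟩
  map_add' _ _ := rfl
  map_smul' _ _ := rfl
  left_inv β := by
    ext v
    simp [Function.comp_def]
  right_inv β := by
    ext v
    simp [Function.comp_def]

variable (p k) in
/-- Two forms are identified if their difference lies in `semibasic p 1 k`. -/
def semibasicSetoid : Setoid (semibasic p 2 k) where
  r β γ := β.1 - γ.1 ∈ semibasic p 1 k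
  iseqv :=
    { refl := fun β => by simp
      symm := fun {β γ} h => by
        have := neg_mem h
        rwa [neg_sub] at this
      trans := fun {β γ δ} h h' => by
        have := add_mem h h'
        rwa [sub_add_sub_cancel] at this }

/-- The quotient of `semibasic p 2 k` by its subspace `semibasic p 1 k`. -/
def SemibasicQuotient (p : X →L[ℝ] Y) (k : ℕ) : Type _ := Quotient (semibasicSetoid p k)

/-- The class of a form in `SemibasicQuotient`. -/
def SemibasicQuotient.mk (β : semibasic p 2 k) : SemibasicQuotient p k :=
  Quotient.mk (semibasicSetoid p k) β

variable (V₁ V₂) in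
/-- The projection `(v, w) ↦ (v, 0)`. -/
def horProj : V₁ × V₂ →L[ℝ] V₁ × V₂ :=
  (ContinuousLinearMap.inl ℝ V₁ V₂).comp (ContinuousLinearMap.fst ℝ V₁ V₂)

variable (V₁ V₂ k) in
/-- The forms in `semibasic 2 k` without horizontal component; they represent each class modulo
`semibasic 1 k` exactly once. -/
def verticalForms : Submodule ℝ ((V₁ × V₂) [⋀^Fin k]→L[ℝ] ℝ) where
  carrier := {β | β ∈ semibasic (ContinuousLinearMap.fst ℝ V₁ V₂) 2 k ∧
    β.compContinuousLinearMap (horProj V₁ V₂) = 0}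
  add_mem' := fun ha hb => ⟨add_mem ha.1 hb.1, by
    ext v
    have h1 := DFunLike.congr_fun ha.2 v
    have h2 := DFunLike.congr_fun hb.2 v
    simp only [ContinuousAlternatingMap.compContinuousLinearMap_apply,
      ContinuousAlternatingMap.coe_zero, Pi.zero_apply] at h1 h2
    simp [h1, h2]⟩
  zero_mem' := ⟨zero_mem _, rfl⟩
  smul_mem' := fun c a ha => ⟨Submodule.smul_mem _ c ha.1, by
    ext v
    have h1 := DFunLike.congr_fun ha.2 v
    simp only [ContinuousAlternatingMap.compContinuousLinearMap_apply,
      ContinuousAlternatingMap.coe_zero, Pi.zero_apply] at h1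
    simp [h1]⟩

theorem horProj_comp_mem_one (β : (V₁ × V₂) [⋀^Fin k]→L[ℝ] ℝ) :
    β.compContinuousLinearMap (horProj V₁ V₂) ∈
      semibasic (ContinuousLinearMap.fst ℝ V₁ V₂) 1 k := by
  intro v s hs hv
  obtain ⟨i, rfl⟩ := Finset.card_eq_one.1 hs
  have h1 : (v i).1 = 0 := hv i (Finset.mem_singleton_self i)
  exact β.map_coord_zero i (by simp [horProj, h1])

theorem semibasic_one_le_two : semibasic p 1 k ≤ semibasic p 2 k := by
  intro β hβ v s hs hv
  obtain ⟨i, j, hij, rfl⟩ := Finset.card_eq_two.1 hs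
  exact hβ v {i} (Finset.card_singleton i) fun l hl => hv l (by simp_all)

theorem eq_horProj_of_mem_one {β : (V₁ × V₂) [⋀^Fin k]→L[ℝ] ℝ}
    (hβ : β ∈ semibasic (ContinuousLinearMap.fst ℝ V₁ V₂) 1 k) :
    β.compContinuousLinearMap (horProj V₁ V₂) = β := by
  ext v
  have key : ∀ s : Finset (Fin k),
      β (s.piecewise (horProj V₁ V₂ ∘ v) v) = β v := by
    intro s
    induction s using Finset.induction_on with
    | empty => simp
    | insert i s hi ih =>
      rw [← ih, Finset.piecewise_insert, ← sub_eq_zero]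
      have h2 : s.piecewise (horProj V₁ V₂ ∘ v) v = update (s.piecewise (horProj V₁ V₂ ∘ v) v) i
          (v i) := by
        rw [eq_comm, update_eq_self_iff, Finset.piecewise_eq_of_notMem _ _ _ hi]
      conv_lhs => rw [h2]
      rw [update_idem, ← ContinuousAlternatingMap.map_update_sub]
      refine hβ _ {i} (Finset.card_singleton i) fun l hl => ?_
      rw [Finset.mem_singleton.1 hl]
      simp [horProj]
  have := key Finset.univ
  rw [Finset.piecewise_univ] at this
  exact this

variable (V₁ V₂ k) in
/-- Removal of the horizontal component. -/
def removeHor (β : semibasic (ContinuousLinearMap.fst ℝ V₁ V₂) 2 k) : verticalForms V₁ V₂ k :=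
  ⟨β.1 - β.1.compContinuousLinearMap (horProj V₁ V₂),
    sub_mem β.2 (semibasic_one_le_two (horProj_comp_mem_one _)), by
      ext v
      simp [horProj, Function.comp_def]⟩

theorem removeHor_eq_iff (β γ : semibasic (ContinuousLinearMap.fst ℝ V₁ V₂) 2 k) :
    removeHor V₁ V₂ k β = removeHor V₁ V₂ k γ ↔
      β.1 - γ.1 ∈ semibasic (ContinuousLinearMap.fst ℝ V₁ V₂) 1 k := by
  have e : ∀ v, (β.1 - γ.1).compContinuousLinearMap (horProj V₁ V₂) v =
      β.1.compContinuousLinearMap (horProj V₁ V₂) v -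
      γ.1.compContinuousLinearMap (horProj V₁ V₂) v := fun v => rfl
  constructor
  · intro h
    have h1 := congrArg Subtype.val h
    have h2 : β.1 - γ.1 = (β.1 - γ.1).compContinuousLinearMap (horProj V₁ V₂) := by
      ext v
      have h3 := DFunLike.congr_fun h1 v
      rw [e]
      simp only [removeHor, ContinuousAlternatingMap.sub_apply] at h3 ⊢
      linarith
    rw [h2]
    exact horProj_comp_mem_one _
  · intro h
    have h1 := eq_horProj_of_mem_one h
    apply Subtype.ext
    ext v
    have h3 := DFunLike.congr_fun h1 v
    rw [e] at h3
    simp only [removeHor, ContinuousAlternatingMap.sub_apply] at h3 ⊢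
    linarith

/-- Classes of semibasic forms in linear coordinates adapted to `p`. -/
def semibasicQuotientEquiv (a : X ≃L[ℝ] V₁ × V₂) (b : Y ≃L[ℝ] V₁)
    (h : ∀ x, (a x).1 = b (p x)) (k : ℕ) :
    SemibasicQuotient p k ≃ verticalForms V₁ V₂ k where
  toFun := Quotient.lift (fun β => removeHor V₁ V₂ k (semibasicEquiv a b h 2 k β))
    fun β γ hr => (removeHor_eq_iff _ _).2 (semibasicEquiv a b h 1 k ⟨β.1 - γ.1, hr⟩).2
  invFun δ := SemibasicQuotient.mk ((semibasicEquiv a b h 2 k).symm ⟨δ.1, δ.2.1⟩)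
  left_inv := by
    refine Quotient.ind fun β => Quotient.sound ?_
    have h1 := horProj_comp_mem_one (V₁ := V₁) (V₂ := V₂) (semibasicEquiv a b h 2 k β).1
    have h2 := ((semibasicEquiv a b h 1 k).symm ⟨_, neg_mem h1⟩).2
    change _ ∈ semibasic p 1 k
    convert h2 using 1
    have h3 := congrArg Subtype.val ((semibasicEquiv a b h 2 k).symm_apply_apply β)
    ext v
    have h4 := DFunLike.congr_fun h3 v
    change (semibasicEquiv a b h 2 k β).1 (a ∘ v) -
      (semibasicEquiv a b h 2 k β).1 (horProj V₁ V₂ ∘ a ∘ v) - β.1 v =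
      -(semibasicEquiv a b h 2 k β).1 (horProj V₁ V₂ ∘ a ∘ v)
    have h5 : (semibasicEquiv a b h 2 k β).1 (a ∘ v) = β.1 v := h4
    rw [h5]
    ring
  right_inv := by
    intro δ
    apply Subtype.ext
    change ((semibasicEquiv a b h 2 k) ((semibasicEquiv a b h 2 k).symm ⟨δ.1, δ.2.1⟩)).1 -
      ((semibasicEquiv a b h 2 k)
        ((semibasicEquiv a b h 2 k).symm ⟨δ.1, δ.2.1⟩)).1.compContinuousLinearMap
          (horProj V₁ V₂) = δ.1
    rw [LinearEquiv.apply_symm_apply]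
    change δ.1 - δ.1.compContinuousLinearMap (horProj V₁ V₂) = δ.1
    rw [δ.2.2, sub_zero]

theorem semibasicQuotientEquiv_mk (a : X ≃L[ℝ] V₁ × V₂) (b : Y ≃L[ℝ] V₁)
    (h : ∀ x, (a x).1 = b (p x)) (k : ℕ) (β : semibasic p 2 k) :
    semibasicQuotientEquiv a b h k (SemibasicQuotient.mk β) =
      removeHor V₁ V₂ k (semibasicEquiv a b h 2 k β) := rfl

end Linear

/-! ### Fibred manifolds and their adapted charts -/

/-- `π : E → M` is a fibred manifold with `dim M = m` and `dim E = m + n`: a surjective smooth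
submersion. In particular every smooth fibre bundle is one. -/
class IsFibredManifold (m n : ℕ) {M E : Type*} [TopologicalSpace M] [ChartedSpace (Euc m) M]
    [TopologicalSpace E] [ChartedSpace (Euc (m + n)) E] (π : E → M) : Prop where
  surjective : Surjective π
  submersion : Manifold.IsSubmersionOfComplement (Euc n) (𝓡 (m + n)) (𝓡 m) ∞ π

section Adapted

variable (m n : ℕ) {M E : Type*} [TopologicalSpace M] [ChartedSpace (Euc m) M]
  [TopologicalSpace E] [ChartedSpace (Euc (m + n)) E] (π : E → M) [hπ : IsFibredManifold m n π]

/-- Coordinates `(x, y)` on `E` around `i`, adapted to `π`. -/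
def adapted (i : E) : OpenPartialHomeomorph E (Euc m × Euc n) :=
  (hπ.submersion i).domChart.transHomeomorph (hπ.submersion i).equiv.toHomeomorph

/-- The coordinates `x` on `M` underlying `adapted i`. -/
def adaptedBase (i : E) : OpenPartialHomeomorph M (Euc m) := (hπ.submersion i).codChart

theorem mem_adapted (i : E) : i ∈ (adapted m n π i).source :=
  (hπ.submersion i).mem_domChart_source

theorem map_adapted {i u : E} (hu : u ∈ (adapted m n π i).source) :
    π u ∈ (adaptedBase m n π i).source :=
  (hπ.submersion i).source_subset_preimage_source hu

theorem fst_adapted {i u : E} (hu : u ∈ (adapted m n π i).source) :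
    (adapted m n π i u).1 = adaptedBase m n π i (π u) := by
  have hu' : u ∈ (hπ.submersion i).domChart.source := hu
  have ht : (hπ.submersion i).domChart u ∈
      ((hπ.submersion i).domChart.extend (𝓡 (m + n))).target := by
    simpa using (hπ.submersion i).domChart.map_source hu'
  have h := (hπ.submersion i).writtenInCharts ht
  simp only [Function.comp_apply, OpenPartialHomeomorph.extend_coe,
    OpenPartialHomeomorph.extend_coe_symm, modelWithCornersSelf_coe,
    modelWithCornersSelf_coe_symm, id] at h
  rw [OpenPartialHomeomorph.left_inv _ hu'] at h
  exact h.symm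

theorem contMDiffOn_adapted (i : E) : ContMDiffOn (𝓡 (m + n)) 𝓘(ℝ, Euc m × Euc n) ∞
    (adapted m n π i) (adapted m n π i).source :=
  (hπ.submersion i).equiv.contDiff.contMDiff.comp_contMDiffOn
    (contMDiffOn_of_mem_maximalAtlas (hπ.submersion i).domChart_mem_maximalAtlas)

theorem contMDiffOn_adapted_symm (i : E) : ContMDiffOn 𝓘(ℝ, Euc m × Euc n) (𝓡 (m + n)) ∞
    (adapted m n π i).symm (adapted m n π i).target :=
  (contMDiffOn_symm_of_mem_maximalAtlas (hπ.submersion i).domChart_mem_maximalAtlas).comp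
    (hπ.submersion i).equiv.symm.contDiff.contMDiff.contMDiffOn fun _ hz => hz

theorem mdifferentiable_adapted (i : E) :
    (adapted m n π i).MDifferentiable (𝓡 (m + n)) 𝓘(ℝ, Euc m × Euc n) :=
  ⟨(contMDiffOn_adapted m n π i).mdifferentiableOn (by simp),
    (contMDiffOn_adapted_symm m n π i).mdifferentiableOn (by simp)⟩

theorem mdifferentiable_adaptedBase (i : E) :
    (adaptedBase m n π i).MDifferentiable (𝓡 m) (𝓡 m) :=
  ⟨(contMDiffOn_of_mem_maximalAtlas
      (hπ.submersion i).codChart_mem_maximalAtlas).mdifferentiableOn (by simp),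
    (contMDiffOn_symm_of_mem_maximalAtlas
      (hπ.submersion i).codChart_mem_maximalAtlas).mdifferentiableOn (by simp)⟩

/-- The differential of `adapted i` at `u`. -/
def dAdapted (i u : E) (hu : u ∈ (adapted m n π i).source) :
    TangentSpace (𝓡 (m + n)) u ≃L[ℝ] Euc m × Euc n :=
  (mdifferentiable_adapted m n π i).mfderiv hu

/-- The differential of `adaptedBase i` at `π u`. -/
def dAdaptedBase (i u : E) (hu : u ∈ (adapted m n π i).source) :
    TangentSpace (𝓡 m) (π u) ≃L[ℝ] Euc m :=
  (mdifferentiable_adaptedBase m n π i).mfderiv (map_adapted m n π hu)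

theorem mdifferentiable_proj : MDifferentiable (𝓡 (m + n)) (𝓡 m) π := fun u =>
  (hπ.submersion u).contMDiffAt.mdifferentiableAt (by simp)

theorem fst_dAdapted (i u : E) (hu : u ∈ (adapted m n π i).source)
    (v : TangentSpace (𝓡 (m + n)) u) :
    (dAdapted m n π i u hu v).1 =
      dAdaptedBase m n π i u hu (mfderiv (𝓡 (m + n)) (𝓡 m) π u v) := by
  have h1 : HasMFDerivAt (𝓡 (m + n)) 𝓘(ℝ, Euc m) (fun w => (adapted m n π i w).1) u
      ((ContinuousLinearMap.fst ℝ (Euc m) (Euc n)).comp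
        (mfderiv (𝓡 (m + n)) 𝓘(ℝ, Euc m × Euc n) (adapted m n π i) u)) :=
    (ContinuousLinearMap.fst ℝ (Euc m) (Euc n)).hasMFDerivAt.comp u
      ((mdifferentiable_adapted m n π i).mdifferentiableAt hu).hasMFDerivAt
  have h2 : HasMFDerivAt (𝓡 (m + n)) 𝓘(ℝ, Euc m) (adaptedBase m n π i ∘ π) u
      ((mfderiv (𝓡 m) (𝓡 m) (adaptedBase m n π i) (π u)).comp
        (mfderiv (𝓡 (m + n)) (𝓡 m) π u)) :=
    ((mdifferentiable_adaptedBase m n π i).mdifferentiableAt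
      (map_adapted m n π hu)).hasMFDerivAt.comp u (mdifferentiable_proj m n π u).hasMFDerivAt
  have h3 : (fun w => (adapted m n π i w).1) =ᶠ[𝓝 u] adaptedBase m n π i ∘ π :=
    Filter.eventuallyEq_of_mem ((adapted m n π i).open_source.mem_nhds hu)
      fun w hw => fst_adapted m n π hw
  have h4 := hasMFDerivAt_unique h1 (h2.congr_of_eventuallyEq h3)
  exact DFunLike.congr_fun h4 v

/-- The change of adapted coordinates. -/
def adaptedChange (i j : E) : Euc m × Euc n → Euc m × Euc n :=
  adapted m n π j ∘ (adapted m n π i).symm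

theorem contDiffOn_adaptedChange (i j : E) : ContDiffOn ℝ ∞ (adaptedChange m n π i j)
    ((adapted m n π i).symm.trans (adapted m n π j)).source := by
  rw [← contMDiffOn_iff_contDiffOn]
  exact (contMDiffOn_adapted m n π j).comp
    ((contMDiffOn_adapted_symm m n π i).mono fun z hz => hz.1) fun z hz => hz.2

theorem contDiffOn_fderiv_adaptedChange (i j : E) :
    ContDiffOn ℝ ∞ (fderiv ℝ (adaptedChange m n π i j))
      ((adapted m n π i).symm.trans (adapted m n π j)).source :=
  (contDiffOn_adaptedChange m n π i j).fderiv_of_isOpen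
    (OpenPartialHomeomorph.open_source _) (by simp)

theorem contDiffOn_fderiv_adaptedChange' (i j : E) :
    ContDiffOn ℝ ∞ (fun z => fderiv ℝ (adaptedChange m n π j i) (adaptedChange m n π i j z))
      ((adapted m n π i).symm.trans (adapted m n π j)).source := by
  refine (contDiffOn_fderiv_adaptedChange m n π j i).comp (contDiffOn_adaptedChange m n π i j) ?_
  rintro z ⟨hz, hz'⟩
  have hz' : (adapted m n π i).symm z ∈ (adapted m n π j).source := hz'
  refine ⟨(adapted m n π j).map_source hz', ?_⟩
  change (adapted m n π j).symm (adapted m n π j ((adapted m n π i).symm z)) ∈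
    (adapted m n π i).source
  rw [(adapted m n π j).left_inv hz']
  exact (adapted m n π i).map_target hz

theorem fderiv_adaptedChange (i j u : E) (hi : u ∈ (adapted m n π i).source)
    (hj : u ∈ (adapted m n π j).source) (v : TangentSpace (𝓡 (m + n)) u) :
    fderiv ℝ (adaptedChange m n π i j) (adapted m n π i u) (dAdapted m n π i u hi v) =
      dAdapted m n π j u hj v := by
  have hz : adapted m n π i u ∈ ((adapted m n π i).symm.trans (adapted m n π j)).source :=
    ⟨(adapted m n π i).map_source hi, by
      change (adapted m n π i).symm (adapted m n π i u) ∈ (adapted m n π j).source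
      rwa [(adapted m n π i).left_inv hi]⟩
  have h0 : DifferentiableAt ℝ (adaptedChange m n π i j) (adapted m n π i u) :=
    ((contDiffOn_adaptedChange m n π i j).contDiffAt
      ((OpenPartialHomeomorph.open_source _).mem_nhds hz)).differentiableAt (by simp)
  have h1 : HasMFDerivAt (𝓡 (m + n)) 𝓘(ℝ, Euc m × Euc n)
      (adaptedChange m n π i j ∘ adapted m n π i) u
      ((fderiv ℝ (adaptedChange m n π i j) (adapted m n π i u)).comp
        (mfderiv (𝓡 (m + n)) 𝓘(ℝ, Euc m × Euc n) (adapted m n π i) u)) :=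
    h0.hasFDerivAt.hasMFDerivAt.comp u
      ((mdifferentiable_adapted m n π i).mdifferentiableAt hi).hasMFDerivAt
  have h2 := ((mdifferentiable_adapted m n π j).mdifferentiableAt hj).hasMFDerivAt
  have h3 : adaptedChange m n π i j ∘ adapted m n π i =ᶠ[𝓝 u] adapted m n π j :=
    Filter.eventuallyEq_of_mem ((adapted m n π i).open_source.mem_nhds hi) fun w hw => by
      simp [adaptedChange, (adapted m n π i).left_inv hw]
  have h4 := hasMFDerivAt_unique h1 (h2.congr_of_eventuallyEq h3)
  exact DFunLike.congr_fun h4 v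

end Adapted

/-! ### The first jet bundle and the multimomentum bundles as smooth manifolds -/

section Bundles

variable (m n : ℕ) {M E : Type*} [TopologicalSpace M] [ChartedSpace (Euc m) M]
  [TopologicalSpace E] [ChartedSpace (Euc (m + n)) E] (π : E → M)

/-- The fibre of the first jet bundle over `u`: the jet at `x = π u` of a local section `φ` with
`φ x = u` is encoded by its differential `T_x φ`, a right inverse of `T_u π`. -/
abbrev JetFibre (u : E) : Type :=
  {A : TangentSpace (𝓡 m) (π u) →L[ℝ] TangentSpace (𝓡 (m + n)) u //
    (mfderiv (𝓡 (m + n)) (𝓡 m) π u).comp A = ContinuousLinearMap.id ℝ _}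

/-- The fibre over `u` of the extended dual jet bundle: the `m`-forms on `T_u E` that vanish
whenever two of their arguments are vertical. -/
abbrev ExtDualFibre (u : E) : Type := semibasic (mfderiv (𝓡 (m + n)) (𝓡 m) π u) 2 m

/-- The fibre over `u` of the reduced dual jet bundle: the quotient of `ExtDualFibre` by the
`m`-forms that vanish whenever one of their arguments is vertical. -/
abbrev DualFibre (u : E) : Type := SemibasicQuotient (mfderiv (𝓡 (m + n)) (𝓡 m) π u) m

/-- Typical fibre of the first jet bundle (coordinates `u_i^α`). -/
abbrev JetModel : Type := Euc m →L[ℝ] Euc n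

/-- Typical fibre of the extended dual jet bundle (coordinates `p`, `p_α^i`). -/
abbrev ExtDualModel : Type := semibasic (ContinuousLinearMap.fst ℝ (Euc m) (Euc n)) 2 m

/-- Typical fibre of the reduced dual jet bundle (coordinates `p_α^i`). -/
abbrev DualModel : Type := verticalForms (Euc m) (Euc n) m

/-- The first jet bundle `J¹π`. -/
def Jet : Type _ := Bundle.TotalSpace (JetModel m n) (JetFibre m n π)

/-- The extended dual jet bundle `Λ₂ᵐ(T*E)`. -/
def ExtDual : Type _ := Bundle.TotalSpace (ExtDualModel m n) (ExtDualFibre m n π)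

/-- The reduced dual jet bundle `J¹π* = Λ₂ᵐ(T*E) / Λ₁ᵐ(T*E)`. -/
def Dual : Type _ := Bundle.TotalSpace (DualModel m n) (DualFibre m n π)

variable [hπ : IsFibredManifold m n π]

/-- Natural coordinates on `J¹π`. -/
def jetCharts : FibreCharts (Euc m × Euc n) (JetModel m n) (JetFibre m n π) where
  base := adapted m n π
  mem_base := mem_adapted m n π
  fib i u hu := sectionEquiv (dAdapted m n π i u hu) (dAdaptedBase m n π i u hu)
    (fst_dAdapted m n π i u hu)
  smooth_base := contDiffOn_adaptedChange m n π
  smooth_fib i j := by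
    refine ⟨fun q => (ContinuousLinearMap.snd ℝ (Euc m) (Euc n)).comp
      ((fderiv ℝ (adaptedChange m n π i j) q.1).comp
        (((ContinuousLinearMap.id ℝ (Euc m)).prod q.2).comp
          ((ContinuousLinearMap.fst ℝ (Euc m) (Euc n)).comp
            ((fderiv ℝ (adaptedChange m n π j i) (adaptedChange m n π i j q.1)).comp
              (ContinuousLinearMap.inl ℝ (Euc m) (Euc n)))))), ?_, ?_⟩
    · have h1 := (contDiffOn_fderiv_adaptedChange m n π i j).comp
        (contDiffOn_fst (F := JetModel m n) (s := ((adapted m n π i).symm.trans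
          (adapted m n π j)).source ×ˢ (univ : Set (JetModel m n)))) fun q hq => hq.1
      have h2 := (contDiffOn_fderiv_adaptedChange' m n π i j).comp
        (contDiffOn_fst (F := JetModel m n) (s := ((adapted m n π i).symm.trans
          (adapted m n π j)).source ×ˢ (univ : Set (JetModel m n)))) fun q hq => hq.1
      have h3 : ContDiff ℝ ∞ (fun B : JetModel m n =>
          (ContinuousLinearMap.id ℝ (Euc m)).prod B) := by
        have h4 : (fun B : JetModel m n => (ContinuousLinearMap.id ℝ (Euc m)).prod B) =
            fun B => (ContinuousLinearMap.inl ℝ (Euc m) (Euc n)) +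
              (ContinuousLinearMap.inr ℝ (Euc m) (Euc n)).comp B := by
          funext B
          ext v <;> simp
        rw [h4]
        exact contDiff_const.add (contDiff_const.clm_comp contDiff_id)
      exact contDiffOn_const.clm_comp (h1.clm_comp ((h3.comp contDiff_snd).contDiffOn.clm_comp
        (contDiffOn_const.clm_comp (h2.clm_comp contDiffOn_const))))
    · intro u hi hj A
      refine sectionEquiv_change _ _ _ _ _ _ _ _ (fderiv_adaptedChange m n π i j u hi hj)
        (fun v => ?_) A
      have h1 : adaptedChange m n π i j (adapted m n π i u) = adapted m n π j u := by
        simp [adaptedChange, (adapted m n π i).left_inv hi]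
      rw [h1]
      exact fderiv_adaptedChange m n π j i u hj hi v

theorem semibasicEquiv_change (i j u : E) (hi : u ∈ (adapted m n π i).source)
    (hj : u ∈ (adapted m n π j).source) (β : ExtDualFibre m n π u) :
    (semibasicEquiv (dAdapted m n π j u hj) (dAdaptedBase m n π j u hj)
      (fst_dAdapted m n π j u hj) 2 m β).1 =
    (semibasicEquiv (dAdapted m n π i u hi) (dAdaptedBase m n π i u hi)
      (fst_dAdapted m n π i u hi) 2 m β).1.compContinuousLinearMap
      (fderiv ℝ (adaptedChange m n π j i) (adaptedChange m n π i j (adapted m n π i u))) := by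
  have h1 : adaptedChange m n π i j (adapted m n π i u) = adapted m n π j u := by
    simp [adaptedChange, (adapted m n π i).left_inv hi]
  rw [h1]
  ext v
  change β.1 (fun k => (dAdapted m n π j u hj).symm (v k)) =
    β.1 (fun k => (dAdapted m n π i u hi).symm
      (fderiv ℝ (adaptedChange m n π j i) (adapted m n π j u) (v k)))
  congr 1
  funext k
  obtain ⟨w, hw⟩ := (dAdapted m n π j u hj).surjective (v k)
  rw [← hw, fderiv_adaptedChange m n π j i u hj hi w]
  simp

theorem extDual_change (i j u : E) (hi : u ∈ (adapted m n π i).source)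
    (hj : u ∈ (adapted m n π j).source) (β : ExtDualFibre m n π u) :
    semibasicEquiv (dAdapted m n π j u hj) (dAdaptedBase m n π j u hj)
      (fst_dAdapted m n π j u hj) 2 m β =
    subspaceProj _ ((semibasicEquiv (dAdapted m n π i u hi) (dAdaptedBase m n π i u hi)
      (fst_dAdapted m n π i u hi) 2 m β).1.compContinuousLinearMap
      (fderiv ℝ (adaptedChange m n π j i) (adaptedChange m n π i j (adapted m n π i u)))) := by
  rw [← semibasicEquiv_change m n π i j u hi hj β, subspaceProj_coe]

/-- Natural coordinates on `Λ₂ᵐ(T*E)`. -/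
def extDualCharts : FibreCharts (Euc m × Euc n) (ExtDualModel m n) (ExtDualFibre m n π) where
  base := adapted m n π
  mem_base := mem_adapted m n π
  fib i u hu := (semibasicEquiv (dAdapted m n π i u hu) (dAdaptedBase m n π i u hu)
    (fst_dAdapted m n π i u hu) 2 m).toEquiv
  smooth_base := contDiffOn_adaptedChange m n π
  smooth_fib i j := ⟨_, contDiffOn_proj_pullback _ (contDiffOn_fderiv_adaptedChange' m n π i j),
    extDual_change m n π i j⟩

theorem dual_change (i j u : E) (hi : u ∈ (adapted m n π i).source)
    (hj : u ∈ (adapted m n π j).source) (q : DualFibre m n π u) :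
    semibasicQuotientEquiv (dAdapted m n π j u hj) (dAdaptedBase m n π j u hj)
      (fst_dAdapted m n π j u hj) m q =
    subspaceProj _ ((semibasicQuotientEquiv (dAdapted m n π i u hi) (dAdaptedBase m n π i u hi)
      (fst_dAdapted m n π i u hi) m q).1.compContinuousLinearMap
      (fderiv ℝ (adaptedChange m n π j i) (adaptedChange m n π i j (adapted m n π i u))) -
      ((semibasicQuotientEquiv (dAdapted m n π i u hi) (dAdaptedBase m n π i u hi)
      (fst_dAdapted m n π i u hi) m q).1.compContinuousLinearMap
      (fderiv ℝ (adaptedChange m n π j i)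
        (adaptedChange m n π i j (adapted m n π i u)))).compContinuousLinearMap
        (horProj (Euc m) (Euc n))) := by
  refine Quotient.inductionOn q fun β => ?_
  have h := semibasicEquiv_change m n π i j u hi hj β
  set βi := semibasicEquiv (dAdapted m n π i u hi) (dAdaptedBase m n π i u hi)
    (fst_dAdapted m n π i u hi) 2 m β with hβi
  set βj := semibasicEquiv (dAdapted m n π j u hj) (dAdaptedBase m n π j u hj)
    (fst_dAdapted m n π j u hj) 2 m β with hβj
  set T := fderiv ℝ (adaptedChange m n π j i) (adaptedChange m n π i j (adapted m n π i u))
    with hT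
  have h1 : adaptedChange m n π i j (adapted m n π i u) = adapted m n π j u := by
    simp [adaptedChange, (adapted m n π i).left_inv hi]
  have hvert : ∀ x : Euc m × Euc n, ContinuousLinearMap.fst ℝ (Euc m) (Euc n) x = 0 →
      ContinuousLinearMap.fst ℝ (Euc m) (Euc n) (T x) = 0 := by
    intro x hx
    obtain ⟨w, rfl⟩ := (dAdapted m n π j u hj).surjective x
    rw [hT, h1, fderiv_adaptedChange m n π j i u hj hi w]
    change (dAdapted m n π i u hi w).1 = 0
    have hx : (dAdapted m n π j u hj w).1 = 0 := hx
    rw [fst_dAdapted] at hx ⊢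
    rw [(dAdaptedBase m n π j u hj).map_eq_zero_iff.1 hx, map_zero]
  have h2 := eq_horProj_of_mem_one (comp_mem_semibasic T hvert (horProj_comp_mem_one βi.1))
  have h3 : (removeHor (Euc m) (Euc n) m βi).1.compContinuousLinearMap T -
      ((removeHor (Euc m) (Euc n) m βi).1.compContinuousLinearMap T).compContinuousLinearMap
        (horProj (Euc m) (Euc n)) = (removeHor (Euc m) (Euc n) m βj).1 := by
    ext v
    have h4 := DFunLike.congr_fun h2 v
    change (βi.1 (T ∘ v) - βi.1 (horProj _ _ ∘ T ∘ v)) -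
      (βi.1 (T ∘ horProj _ _ ∘ v) - βi.1 (horProj _ _ ∘ T ∘ horProj _ _ ∘ v)) =
      βj.1 v - βj.1 (horProj _ _ ∘ v)
    change βi.1 (horProj _ _ ∘ T ∘ horProj _ _ ∘ v) = βi.1 (horProj _ _ ∘ T ∘ v) at h4
    rw [h4, h]
    change _ = βi.1 (T ∘ v) - βi.1 (T ∘ horProj _ _ ∘ v)
    ring
  change removeHor (Euc m) (Euc n) m βj = subspaceProj _
    ((removeHor (Euc m) (Euc n) m βi).1.compContinuousLinearMap T -
      ((removeHor (Euc m) (Euc n) m βi).1.compContinuousLinearMap T).compContinuousLinearMap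
        (horProj (Euc m) (Euc n)))
  rw [h3, subspaceProj_coe]

/-- Natural coordinates on `J¹π*`. -/
def dualCharts : FibreCharts (Euc m × Euc n) (DualModel m n) (DualFibre m n π) where
  base := adapted m n π
  mem_base := mem_adapted m n π
  fib i u hu := semibasicQuotientEquiv (dAdapted m n π i u hu) (dAdaptedBase m n π i u hu)
    (fst_dAdapted m n π i u hu) m
  smooth_base := contDiffOn_adaptedChange m n π
  smooth_fib i j := ⟨_, contDiffOn_proj_pullback_sub _ (horProj (Euc m) (Euc n))
    (contDiffOn_fderiv_adaptedChange' m n π i j), dual_change m n π i j⟩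

instance : TopologicalSpace (Jet m n π) := (jetCharts m n π).core.toTopologicalSpace
instance : ChartedSpace ((Euc m × Euc n) × JetModel m n) (Jet m n π) :=
  (jetCharts m n π).core.toChartedSpace
instance : IsManifold 𝓘(ℝ, (Euc m × Euc n) × JetModel m n) ∞ (Jet m n π) :=
  (jetCharts m n π).isManifold

instance : TopologicalSpace (ExtDual m n π) := (extDualCharts m n π).core.toTopologicalSpace
instance : ChartedSpace ((Euc m × Euc n) × ExtDualModel m n) (ExtDual m n π) :=
  (extDualCharts m n π).core.toChartedSpace
instance : IsManifold 𝓘(ℝ, (Euc m × Euc n) × ExtDualModel m n) ∞ (ExtDual m n π) :=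
  (extDualCharts m n π).isManifold

instance : TopologicalSpace (Dual m n π) := (dualCharts m n π).core.toTopologicalSpace
instance : ChartedSpace ((Euc m × Euc n) × DualModel m n) (Dual m n π) :=
  (dualCharts m n π).core.toChartedSpace
instance : IsManifold 𝓘(ℝ, (Euc m × Euc n) × DualModel m n) ∞ (Dual m n π) :=
  (dualCharts m n π).isManifold

end Bundles

/-! ### Forms, multivector fields and distributions on a manifold `N` modelled on `F` -/

section Manifold

variable {F : Type*} [NormedAddCommGroup F] [NormedSpace ℝ F]
  {N : Type*} [TopologicalSpace N] [ChartedSpace F N]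

variable (F N) in
/-- Differential forms of degree `k` (not necessarily smooth). -/
abbrev DiffForm (k : ℕ) : Type _ := ∀ p : N, TangentSpace 𝓘(ℝ, F) p [⋀^Fin k]→L[ℝ] ℝ

/-- The expression of a form in a chart. -/
def DiffForm.inChart {k : ℕ} (α : DiffForm F N k) (e : OpenPartialHomeomorph N F) (z : F) :
    F [⋀^Fin k]→L[ℝ] ℝ :=
  (α (e.symm z)).compContinuousLinearMap (mfderiv 𝓘(ℝ, F) 𝓘(ℝ, F) e.symm z)

/-- Smoothness of a form. -/
def DiffForm.IsSmooth {k : ℕ} (α : DiffForm F N k) : Prop :=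
  ∀ p : N, ContDiffOn ℝ ∞ (α.inChart (chartAt F p)) (chartAt F p).target

/-- The exterior derivative, computed at `p` in the preferred chart at `p`. -/
def DiffForm.d {k : ℕ} (α : DiffForm F N k) : DiffForm F N (k + 1) := fun p =>
  (extDeriv (α.inChart (chartAt F p)) (chartAt F p p)).compContinuousLinearMap
    (mfderiv 𝓘(ℝ, F) 𝓘(ℝ, F) (chartAt F p) p)

/-- The pullback of a form by a map. -/
def DiffForm.pullback {F' : Type*} [NormedAddCommGroup F'] [NormedSpace ℝ F'] {N' : Type*}
    [TopologicalSpace N'] [ChartedSpace F' N'] {k : ℕ} (f : N' → N) (α : DiffForm F N k) :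
    DiffForm F' N' k := fun p =>
  (α (f p)).compContinuousLinearMap (mfderiv 𝓘(ℝ, F') 𝓘(ℝ, F) f p)

variable (F N) in
/-- Vector fields (not necessarily smooth). -/
abbrev VField : Type _ := ∀ p : N, TangentSpace 𝓘(ℝ, F) p

variable (F N) in
/-- Multivector fields of degree `k` (not necessarily smooth). -/
abbrev MVField (k : ℕ) : Type _ := ∀ p : N, ⋀[ℝ]^k (TangentSpace 𝓘(ℝ, F) p)

variable (F N) in
/-- Families of subspaces of the tangent spaces. -/
abbrev TangentDistribution : Type _ := ∀ p : N, Submodule ℝ (TangentSpace 𝓘(ℝ, F) p)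

/-- `i(X)α = 0` for a `k`-multivector field `X` and a `(k+1)`-form `α`: at every point and for
every `w`, the linear functional `X₁ ∧ ⋯ ∧ X_k ↦ α(w, X₁, …, X_k)` vanishes at `X`. -/
def ContractionVanishes {k : ℕ} (X : MVField F N k) (α : DiffForm F N (k + 1)) : Prop :=
  ∀ (p : N) (w : TangentSpace 𝓘(ℝ, F) p),
    exteriorPower.alternatingMapLinearEquiv ((α p).toAlternatingMap.curryLeft w) (X p) = 0

/-- `D` is integrable: through every point passes a `k`-dimensional integral manifold, given by a
parametrisation `f` defined on an open set of `ℝᵏ`. -/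
def TangentDistribution.IsIntegrable (k : ℕ) (D : TangentDistribution F N) : Prop :=
  ∀ p : N, ∃ (U : Set (Euc k)) (f : Euc k → N) (y : Euc k), IsOpen U ∧ y ∈ U ∧ f y = p ∧
    ContMDiffOn (𝓡 k) 𝓘(ℝ, F) ∞ f U ∧
    ∀ z ∈ U, Injective (mfderiv (𝓡 k) 𝓘(ℝ, F) f z) ∧
      (mfderiv (𝓡 k) 𝓘(ℝ, F) f z).range = D (f z)

variable [IsManifold 𝓘(ℝ, F) ∞ N]

/-- Smoothness of a vector field on a set. -/
def VField.SmoothOn (X : VField F N) (U : Set N) : Prop :=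
  ContMDiffOn 𝓘(ℝ, F) (𝓘(ℝ, F).tangent) ∞
    (fun p => (⟨p, X p⟩ : TangentBundle 𝓘(ℝ, F) N)) U

/-- `D` is a smooth distribution of dimension `k`: a subbundle of rank `k` of the tangent bundle. -/
def TangentDistribution.HasRank (k : ℕ) (D : TangentDistribution F N) : Prop :=
  ∀ p : N, ∃ (U : Set N) (X : Fin k → VField F N), IsOpen U ∧ p ∈ U ∧ (∀ i, (X i).SmoothOn U) ∧
    ∀ q ∈ U, LinearIndependent ℝ (fun i => X i q) ∧ D q = Submodule.span ℝ (range fun i => X i q)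

/-- `X` is locally decomposable: locally the exterior product of smooth vector fields. -/
def MVField.IsLocallyDecomposable {k : ℕ} (X : MVField F N k) : Prop :=
  ∀ p : N, ∃ (U : Set N) (Y : Fin k → VField F N), IsOpen U ∧ p ∈ U ∧ (∀ i, (Y i).SmoothOn U) ∧
    ∀ q ∈ U, X q = exteriorPower.ιMulti ℝ k (fun i => Y i q)

/-- `X` belongs to the class of multivector fields associated with the distribution `D`: it is a
non-vanishing, locally decomposable `k`-multivector field and a section of `Λᵏ D`. -/
structure MVField.IsAssociated {k : ℕ} (X : MVField F N k) (D : TangentDistribution F N) : Prop where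
  ne_zero : ∀ p, X p ≠ 0
  locallyDecomposable : X.IsLocallyDecomposable
  mem : ∀ p, X p ∈ LinearMap.range (exteriorPower.map k (D p).subtype)

end Manifold

/-! ### Local sections and integral sections -/

section Sections

variable {m : ℕ} {M : Type*} [TopologicalSpace M] [ChartedSpace (Euc m) M]
  {F : Type*} [NormedAddCommGroup F] [NormedSpace ℝ F]
  {N : Type*} [TopologicalSpace N] [ChartedSpace F N]

/-- `ψ` is a local section of `ρ : N → M` defined on the open set `U`. -/
structure IsLocalSection (ρ : N → M) (U : Set M) (ψ : M → N) : Prop where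
  isOpen : IsOpen U
  smooth : ContMDiffOn (𝓡 m) 𝓘(ℝ, F) ∞ ψ U
  proj : ∀ x ∈ U, ρ (ψ x) = x

/-- The image of `ψ : U → N` is an integral manifold of `D`. -/
def TangentDistribution.IsIntegralSection (D : TangentDistribution F N) (U : Set M) (ψ : M → N) : Prop :=
  ∀ x ∈ U, (mfderiv (𝓡 m) 𝓘(ℝ, F) ψ x).range = D (ψ x)

/-- `D` is transverse to `ρ : N → M`: no non-zero vector of `D` is `ρ`-vertical. -/
def TangentDistribution.IsTransverse (D : TangentDistribution F N) (ρ : N → M) : Prop :=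
  ∀ p, Disjoint (D p) (mfderiv 𝓘(ℝ, F) (𝓡 m) ρ p).ker

/-- `η` is a volume form on `M`. -/
structure IsVolumeForm (η : DiffForm (Euc m) M m) : Prop where
  smooth : η.IsSmooth
  ne_zero : ∀ x, η x ≠ 0

end Sections

/-! ### Projections -/

section Projections

variable {m n : ℕ} {M E : Type*} [TopologicalSpace M] [ChartedSpace (Euc m) M]
  [TopologicalSpace E] [ChartedSpace (Euc (m + n)) E] {π : E → M}

/-- The projection `π¹ : J¹π → E`. -/
def Jet.toE (j : Jet m n π) : E := Bundle.TotalSpace.proj j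

/-- The projection `π̄¹ : J¹π → M`. -/
def Jet.toM (j : Jet m n π) : M := π j.toE

/-- The differential `T_x φ` that represents the jet `j`. -/
def Jet.hom (j : Jet m n π) : TangentSpace (𝓡 m) (π j.toE) →L[ℝ] TangentSpace (𝓡 (m + n)) j.toE :=
  (Bundle.TotalSpace.snd j).1

/-- The jet over `u` given by an element of the fibre. -/
def Jet.mk (u : E) (A : JetFibre m n π u) : Jet m n π := ⟨u, A⟩

/-- The projection `π_E : Λ₂ᵐ(T*E) → E`. -/
def ExtDual.toE (b : ExtDual m n π) : E := Bundle.TotalSpace.proj b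

/-- The form `β` that constitutes the point `(u, β)` of `Λ₂ᵐ(T*E)`. -/
def ExtDual.form (b : ExtDual m n π) : TangentSpace (𝓡 (m + n)) b.toE [⋀^Fin m]→L[ℝ] ℝ :=
  (Bundle.TotalSpace.snd b).1

/-- The projection `π_Eʳ : J¹π* → E`. -/
def Dual.toE (b : Dual m n π) : E := Bundle.TotalSpace.proj b

/-- The projection `π̄_Eʳ : J¹π* → M`. -/
def Dual.toM (b : Dual m n π) : M := π b.toE

/-- The point of `J¹π*` over `u` given by an element of the fibre. -/
def Dual.mk (u : E) (q : DualFibre m n π u) : Dual m n π := ⟨u, q⟩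

/-- The quotient map `Λ₂ᵐ(T*E) → J¹π*`. -/
def ExtDual.toDual (b : ExtDual m n π) : Dual m n π :=
  ⟨Bundle.TotalSpace.proj b, SemibasicQuotient.mk (Bundle.TotalSpace.snd b)⟩

end Projections

/-! ### The Cartan forms of a Lagrangian and of a Hamiltonian section -/

section Cartan

/-- For a `k`-form `η` and linear maps `V`, `W`, the `k`-form
`(Y₁, …, Y_k) ↦ ∑ l, η(V Y₁, …, W Y_l, …, V Y_k)`. -/
def insertionSum {X Y : Type*} [AddCommGroup X] [Module ℝ X] [TopologicalSpace X]
    [AddCommGroup Y] [Module ℝ Y] [TopologicalSpace Y] {k : ℕ}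
    (η : Y [⋀^Fin k]→L[ℝ] ℝ) (V W : X →L[ℝ] Y) : X [⋀^Fin k]→L[ℝ] ℝ where
  toContinuousMultilinearMap := ∑ l : Fin k,
    η.toContinuousMultilinearMap.compContinuousLinearMap (fun i => if i = l then W else V)
  map_eq_zero_of_eq' := by
    intro v i j hv hij
    change (∑ l : Fin k, η.toContinuousMultilinearMap.compContinuousLinearMap
      (fun i => if i = l then W else V)) v = 0
    rw [sum_apply,
      ← Finset.sum_subset (Finset.subset_univ {i, j})]
    · rw [Finset.sum_pair hij]
      have h := η.toAlternatingMap.map_swap (fun a => (if a = i then W else V) (v a)) hij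
      have h' : ((fun a => (if a = i then W else V) (v a)) ∘ Equiv.swap i j) =
          fun a => (if a = j then W else V) (v a) := by
        funext a
        by_cases hai : a = i
        · subst hai
          simp [hij, hij.symm, hv]
        · by_cases haj : a = j
          · subst haj
            simp [hv]
          · simp [Equiv.swap_apply_of_ne_of_ne hai haj, hai, haj]
      rw [h'] at h
      change η.toAlternatingMap (fun a => (if a = i then W else V) (v a)) +
        η.toAlternatingMap (fun a => (if a = j then W else V) (v a)) = 0
      rw [h, add_neg_cancel]
    · intro l _ hl
      simp only [Finset.mem_insert, Finset.mem_singleton, not_or] at hl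
      refine η.map_eq_zero_of_eq _ (i := i) (j := j) ?_ hij
      simp [Ne.symm hl.1, Ne.symm hl.2, hv]

variable {m n : ℕ} {M E : Type*} [TopologicalSpace M] [ChartedSpace (Euc m) M]
  [TopologicalSpace E] [ChartedSpace (Euc (m + n)) E] {π : E → M}

variable (m n π) in
/-- `T_u π`, where tangent spaces are written as the model spaces. -/
def dproj (u : E) : Euc (m + n) →L[ℝ] Euc m := mfderiv (𝓡 (m + n)) (𝓡 m) π u

variable (m n π) in
/-- The space `V_u π` of vertical tangent vectors at `u`. -/
def vert (u : E) : Submodule ℝ (Euc (m + n)) := (dproj m n π u).ker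

/-- `Jet.hom`, where tangent spaces are written as the model spaces. -/
def Jet.lift (j : Jet m n π) : Euc m →L[ℝ] Euc (m + n) := j.hom

theorem Jet.dproj_lift (j : Jet m n π) (v : Euc m) : dproj m n π j.toE (j.lift v) = v :=
  DFunLike.congr_fun (Bundle.TotalSpace.snd j).2 v

/-- The affine structure of the fibres of `π¹`: translation of a jet by a linear map
`B : T_x M → V_u π`. -/
def Jet.translate (j : Jet m n π) (B : Euc m →L[ℝ] vert m n π j.toE) : Jet m n π :=
  Jet.mk j.toE ⟨(j.lift + (vert m n π j.toE).subtypeL.comp B : Euc m →L[ℝ] Euc (m + n)), by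
    ext1 v
    change dproj m n π j.toE (j.lift v + (B v : Euc (m + n))) = v
    have h2 : dproj m n π j.toE (B v : Euc (m + n)) = 0 := (B v).2
    rw [map_add, h2, add_zero]
    exact j.dproj_lift v⟩

/-- The derivative at `j` of a function `L` on `J¹π` along the fibre of `π¹`. It is `dL` composed
with the vertical lift of linear maps `B : T_x M → V_u π` to vertical vectors at `j`. -/
def fibreDeriv (L : Jet m n π → ℝ) (j : Jet m n π) :
    (Euc m →L[ℝ] vert m n π j.toE) →L[ℝ] ℝ :=
  fderiv ℝ (fun B => L (j.translate B)) 0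

variable (m n) in
/-- Model vector space of `J¹π`. -/
abbrev JetSpace : Type := (Euc m × Euc n) × JetModel m n

variable (m n) in
/-- Model vector space of `Λ₂ᵐ(T*E)`. -/
abbrev ExtDualSpace : Type := (Euc m × Euc n) × ExtDualModel m n

variable (m n) in
/-- Model vector space of `J¹π*`. -/
abbrev DualSpace : Type := (Euc m × Euc n) × DualModel m n

variable [hπ : IsFibredManifold m n π]

/-- `T_j π¹`, where tangent spaces are written as the model spaces. -/
def dJet (j : Jet m n π) : JetSpace m n →L[ℝ] Euc (m + n) :=
  mfderiv 𝓘(ℝ, JetSpace m n) (𝓡 (m + n)) Jet.toE j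

/-- `T_j π̄¹ = T_u π ∘ T_j π¹`. -/
def dJetBase (j : Jet m n π) : JetSpace m n →L[ℝ] Euc m := (dproj m n π j.toE).comp (dJet j)

/-- The canonical structure form `θ_j(Y) = Tπ¹(Y) - T(φ ∘ π)(Tπ¹(Y))`, where `j` is the jet
of `φ`; it takes values in the vertical vectors. -/
def structureForm (j : Jet m n π) : JetSpace m n →L[ℝ] vert m n π j.toE :=
  (dJet j - j.lift.comp (dJetBase j)).codRestrict (vert m n π j.toE) fun Y => by
    change dproj m n π j.toE (dJet j Y - j.lift (dproj m n π j.toE (dJet j Y))) = 0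
    rw [map_sub, j.dproj_lift, sub_self]

/-- The contraction of `dL` with the canonical vertical endomorphism, as the linear map
`Y ↦ ∑ i, dL(vertical lift of dxⁱ ⊗ θ(Y)) ∂/∂xⁱ` from `T_j J¹π` to `T_x M`. -/
def momentum (L : Jet m n π → ℝ) (j : Jet m n π) : JetSpace m n →L[ℝ] Euc m :=
  ∑ i : Fin m, ((fibreDeriv L j).comp ((ContinuousLinearMap.smulRightL ℝ (Euc m) (vert m n π j.toE)
    (EuclideanSpace.proj i)).comp (structureForm j))).smulRight (EuclideanSpace.single i (1 : ℝ))

/-- The Cartan `m`-form `Θ_L = i(ν)d𝓛 + 𝓛` of the Lagrangian density `𝓛 = L η`; in natural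
coordinates with `η = dᵐx` it is
`∂L/∂u_i^α (du^α - u_j^α dxʲ) ∧ dᵐ⁻¹x_i + L dᵐx`. -/
def cartanForm (η : DiffForm (Euc m) M m) (L : Jet m n π → ℝ) :
    DiffForm (JetSpace m n) (Jet m n π) m := fun j =>
  (insertionSum (η (π j.toE) : Euc m [⋀^Fin m]→L[ℝ] ℝ) (dJetBase j) (momentum L j) +
    L j • (η (π j.toE) : Euc m [⋀^Fin m]→L[ℝ] ℝ).compContinuousLinearMap (dJetBase j) :
    JetSpace m n [⋀^Fin m]→L[ℝ] ℝ)

/-- The Cartan `(m+1)`-form `Ω_L = -dΘ_L`. -/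
def cartanMultisymplecticForm (η : DiffForm (Euc m) M m) (L : Jet m n π → ℝ) :
    DiffForm (JetSpace m n) (Jet m n π) (m + 1) := fun j => -(cartanForm η L).d j

variable (m n π) in
/-- The Liouville `m`-form `Θ` on `Λ₂ᵐ(T*E)`. -/
def liouvilleForm : DiffForm (ExtDualSpace m n) (ExtDual m n π) m := fun b =>
  b.form.compContinuousLinearMap
    (mfderiv 𝓘(ℝ, ExtDualSpace m n) (𝓡 (m + n)) ExtDual.toE b)

variable (m n π) in
/-- The Liouville `(m+1)`-form `Ω = -dΘ` on `Λ₂ᵐ(T*E)`. -/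
def liouvilleMultisymplecticForm : DiffForm (ExtDualSpace m n) (ExtDual m n π) (m + 1) := fun b =>
  -(liouvilleForm m n π).d b

/-- `h` is a Hamiltonian section: a smooth section of `Λ₂ᵐ(T*E) → J¹π*`. -/
structure IsHamiltonianSection (h : Dual m n π → ExtDual m n π) : Prop where
  smooth : ContMDiff 𝓘(ℝ, DualSpace m n) 𝓘(ℝ, ExtDualSpace m n) ∞ h
  toDual : ∀ b, (h b).toDual = b

/-- The Hamilton-Cartan `(m+1)`-form `Ω_h = h^*Ω`. -/
def hamiltonCartanMultisymplecticForm (h : Dual m n π → ExtDual m n π) :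
    DiffForm (DualSpace m n) (Dual m n π) (m + 1) := (liouvilleMultisymplecticForm m n π).pullback h

end Cartan

/-! ### The field equations and the generalized Hamilton-Jacobi problem -/

section Problem

variable {m n : ℕ} {M E : Type*} [TopologicalSpace M] [ChartedSpace (Euc m) M]
  [TopologicalSpace E] [ChartedSpace (Euc (m + n)) E] {π : E → M}

/-- The field equation `ψ^* i(X)Ω = 0` on `U` for all vector fields `X`. -/
def SolvesFieldEquation {F N : Type*} [NormedAddCommGroup F] [NormedSpace ℝ F]
    [TopologicalSpace N] [ChartedSpace F N] [IsManifold 𝓘(ℝ, F) ∞ N]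
    (Ω : DiffForm F N (m + 1)) (U : Set M) (ψ : M → N) : Prop :=
  ∀ X : VField F N, X.SmoothOn univ → ∀ x ∈ U, ∀ v : Fin m → TangentSpace (𝓡 m) x,
    Ω (ψ x) (Fin.cons (X (ψ x)) fun i => mfderiv (𝓡 m) 𝓘(ℝ, F) ψ x (v i)) = 0

/-- `ψ = j¹φ` on `U`. -/
def IsProlongation (U : Set M) (φ : M → E) (ψ : M → Jet m n π) : Prop :=
  ∀ x ∈ U, (ψ x).toE = φ x ∧
    (ψ x).lift = (mfderiv (𝓡 m) (𝓡 (m + n)) φ x : Euc m →L[ℝ] Euc (m + n))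

variable [hπ : IsFibredManifold m n π]

/-- `D` is a solution of the Lagrangian problem: an `m`-dimensional, `π̄¹`-transverse and integrable
distribution in `J¹π` whose integral sections are prolongations of sections of `π` satisfying the
field equation. -/
structure IsLagrangianSolution (η : DiffForm (Euc m) M m) (L : Jet m n π → ℝ)
    (D : TangentDistribution (JetSpace m n) (Jet m n π)) : Prop where
  hasRank : D.HasRank m
  transverse : D.IsTransverse (m := m) (Jet.toM : Jet m n π → M)
  integrable : D.IsIntegrable m
  sections : ∀ (U : Set M) (ψ : M → Jet m n π),
    IsLocalSection (m := m) (F := JetSpace m n) Jet.toM U ψ → D.IsIntegralSection (m := m) U ψ →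
    ∃ φ : M → E, IsLocalSection (m := m) (F := Euc (m + n)) π U φ ∧ IsProlongation U φ ψ ∧
      SolvesFieldEquation (m := m) (cartanMultisymplecticForm η L) U ψ

/-- `D` is a solution of the Hamiltonian problem: an `m`-dimensional, `π̄_Eʳ`-transverse and
integrable distribution in `J¹π*` whose integral sections satisfy the field equation. -/
structure IsHamiltonianSolution (h : Dual m n π → ExtDual m n π)
    (D : TangentDistribution (DualSpace m n) (Dual m n π)) : Prop where
  hasRank : D.HasRank m
  transverse : D.IsTransverse (m := m) (Dual.toM : Dual m n π → M)
  integrable : D.IsIntegrable m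
  sections : ∀ (U : Set M) (ψ : M → Dual m n π),
    IsLocalSection (m := m) (F := DualSpace m n) Dual.toM U ψ → D.IsIntegralSection (m := m) U ψ →
    SolvesFieldEquation (m := m) (hamiltonCartanMultisymplecticForm h) U ψ

/-- The generalized Hamilton-Jacobi condition for a map `Φ : E → P` into a phase space: if a local
section `γ` of `π` is an integral section of `D`, then `Φ ∘ γ` is one of `DP`. -/
def GenHJCondition {F P : Type*} [NormedAddCommGroup F] [NormedSpace ℝ F]
    [TopologicalSpace P] [ChartedSpace F P] (π : E → M) (D : TangentDistribution (Euc (m + n)) E)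
    (DP : TangentDistribution F P) (Φ : E → P) : Prop :=
  ∀ (U : Set M) (γ : M → E), IsLocalSection (m := m) (F := Euc (m + n)) π U γ → D.IsIntegralSection (m := m) U γ →
    DP.IsIntegralSection (m := m) U (Φ ∘ γ)

end Problem

end FieldHJ

end

open FieldHJ

/-!
Both parts are one construction on a phase space `r : P → E` with a transverse distribution `D'`
(namely `D_L` on the jet bundle, `D_h` on its dual) and a section `σ` of `r`. Transversality makes
`D'` an Ehresmann connection on `π ∘ r`, so a multivector field `X` on `E` can be lifted to `D'`:
project each factor to `M`, then take its horizontal lift. Since `D` is integrable and transverse,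
an integral section `γ` of `D` passes through every point of `E`, and differentiating
`r ∘ σ ∘ γ = γ` gives `D = Tr(D')` along `σ`. Therefore `Tr` carries the horizontal lift of `Tπ v`
back to `v` for `v ∈ D`, and the lift of `X` projects to `X`. Finally, each fibre of `D'` is
tangent to an integral section of `D'`, where the field equation says that the form vanishes on
`m` vectors of `D'` and one arbitrary vector, so its contraction with any section of `Λᵐ D'`
vanishes.
-/

noncomputable section

open Set Function
open scoped Topology

namespace FieldHJ

section Multivectors

variable {R V W N : Type*} [CommRing R] [AddCommGroup V] [Module R V] [AddCommGroup W]
  [Module R W] [AddCommGroup N] [Module R N] {k : ℕ} {D : Submodule R V} {z : ⋀[R]^k V}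

theorem exteriorPower_map_mem_range (A : W →ₗ[R] V) (hA : ∀ w, A w ∈ D) (y : ⋀[R]^k W) :
    exteriorPower.map k A y ∈ LinearMap.range (exteriorPower.map k D.subtype) := by
  refine ⟨exteriorPower.map k (A.codRestrict D hA) y, ?_⟩
  rw [← LinearMap.comp_apply, ← exteriorPower.map_comp, LinearMap.subtype_comp_codRestrict]

theorem exteriorPower_map_eq_self {A : V →ₗ[R] V} (hA : ∀ v ∈ D, A v = v)
    (hz : z ∈ LinearMap.range (exteriorPower.map k D.subtype)) :
    exteriorPower.map k A z = z := by
  obtain ⟨y, rfl⟩ := hz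
  have hAD : A ∘ₗ D.subtype = D.subtype := LinearMap.ext fun v => hA v v.2
  rw [← LinearMap.comp_apply, ← exteriorPower.map_comp, hAD]

theorem alternatingMapLinearEquiv_apply_eq_zero {α : V [⋀^Fin k]→ₗ[R] N}
    (hα : ∀ v : Fin k → V, (∀ i, v i ∈ D) → α v = 0)
    (hz : z ∈ LinearMap.range (exteriorPower.map k D.subtype)) :
    exteriorPower.alternatingMapLinearEquiv α z = 0 := by
  obtain ⟨y, rfl⟩ := hz
  have hcomp : exteriorPower.alternatingMapLinearEquiv α ∘ₗ exteriorPower.map k D.subtype = 0 := by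
    ext v
    simpa [exteriorPower.map_apply_ιMulti, exteriorPower.alternatingMapLinearEquiv_apply_ιMulti]
      using hα (Subtype.val ∘ v) fun i => (v i).2
  exact DFunLike.congr_fun hcomp y

theorem exteriorPower_map_ne_zero {K V W : Type*} [Field K] [AddCommGroup V] [Module K V]
    [AddCommGroup W] [Module K W] {k : ℕ} {D : Submodule K V} {z : ⋀[K]^k V} {A : V →ₗ[K] W}
    (hA : Disjoint D A.ker) (hz : z ∈ LinearMap.range (exteriorPower.map k D.subtype))
    (hz0 : z ≠ 0) : exteriorPower.map k A z ≠ 0 := by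
  obtain ⟨y, rfl⟩ := hz
  have hinj : Injective (A ∘ₗ D.subtype) := LinearMap.injective_domRestrict_iff.2 hA
  rw [← LinearMap.comp_apply, ← exteriorPower.map_comp]
  exact (map_ne_zero_iff _ (exteriorPower.map_injective_field hinj)).2 fun hy =>
    hz0 (hy ▸ map_zero _)

end Multivectors

theorem isInvertible_of_injective {𝕜 V W : Type*} [NontriviallyNormedField 𝕜]
    [CompleteSpace 𝕜] [NormedAddCommGroup V] [NormedSpace 𝕜 V] [FiniteDimensional 𝕜 V]
    [NormedAddCommGroup W] [NormedSpace 𝕜 W] [FiniteDimensional 𝕜 W] {L : V →L[𝕜] W}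
    (hL : Injective L) (hVW : Module.finrank 𝕜 V = Module.finrank 𝕜 W) : L.IsInvertible :=
  ⟨(LinearEquiv.ofInjectiveOfFinrankEq L.toLinearMap hL hVW).toContinuousLinearEquiv, rfl⟩

section InverseFunctionTheorem

section Basic

variable {𝕜 : Type*} [NontriviallyNormedField 𝕜]
  {E : Type*} [NormedAddCommGroup E] [NormedSpace 𝕜 E]
  {F : Type*} [NormedAddCommGroup F] [NormedSpace 𝕜 F]
  {H : Type*} [TopologicalSpace H] {I : ModelWithCorners 𝕜 E H}
  {H' : Type*} [TopologicalSpace H'] {J : ModelWithCorners 𝕜 F H'}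
  {M : Type*} [TopologicalSpace M] [ChartedSpace H M]
  {N : Type*} [TopologicalSpace N] [ChartedSpace H' N] {n : ℕ∞ω} {x : M}

theorem isLocalDiffeomorphAt_openPartialHomeomorph (e : OpenPartialHomeomorph M N)
    (he : ContMDiffOn I J n e e.source) (he_symm : ContMDiffOn J I n e.symm e.target)
    (hx : x ∈ e.source) : IsLocalDiffeomorphAt I J n e x :=
  ⟨⟨e.toPartialEquiv, e.open_source, e.open_target, he, he_symm⟩, hx, eqOn_refl _ _⟩

theorem isLocalDiffeomorphAt_of_eventuallyEq {f g : M → N} (hf : IsLocalDiffeomorphAt I J n f x)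
    (hgf : g =ᶠ[𝓝 x] f) : IsLocalDiffeomorphAt I J n g x := by
  obtain ⟨Φ, hx, hfΦ⟩ := hf
  obtain ⟨t, ht, hto, hxt⟩ := mem_nhds_iff.1 hgf
  let e := Φ.toOpenPartialHomeomorph.restrOpen t hto
  have he : ContMDiffOn I J n e e.source := Φ.contMDiffOn_toFun.mono inter_subset_left
  have he_symm : ContMDiffOn J I n e.symm e.target :=
    Φ.contMDiffOn_invFun.mono inter_subset_left
  exact ⟨⟨e.toPartialEquiv, e.open_source, e.open_target, he, he_symm⟩, ⟨hx, hxt⟩,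
    fun y hy => (ht hy.2).trans (hfΦ hy.1)⟩

end Basic

variable {𝕜 : Type*} [RCLike 𝕜] {E : Type*} [NormedAddCommGroup E] [NormedSpace 𝕜 E]
  [CompleteSpace E] {F : Type*} [NormedAddCommGroup F] [NormedSpace 𝕜 F] {n : ℕ∞ω}

theorem isLocalDiffeomorphAt_of_hasFDerivAt {f : E → F} {s : Set E} (hs : IsOpen s)
    (hf : ContDiffOn 𝕜 n f s) (hn : n ≠ 0) {a : E} (ha : a ∈ s) {A : E ≃L[𝕜] F}
    (hA : HasFDerivAt f (A : E →L[𝕜] F) a) :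
    IsLocalDiffeomorphAt 𝓘(𝕜, E) 𝓘(𝕜, F) n f a := by
  have hfs : ∀ z ∈ s, ContDiffAt 𝕜 n f z := fun z hz => hf.contDiffAt (hs.mem_nhds hz)
  -- The set of invertible maps is open: shrinking `s` to `t` makes the inverse smooth on all of
  -- its domain rather than only at `f a`.
  let t : Set E := s ∩ fderiv 𝕜 f ⁻¹' range ((↑) : (E ≃L[𝕜] F) → E →L[𝕜] F)
  have hdf : ContinuousOn (fderiv 𝕜 f) s :=
    hf.continuousOn_fderiv_of_isOpen hs (ENat.one_le_iff_ne_zero_withTop.2 hn)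
  have ht : IsOpen t := hdf.isOpen_inter_preimage hs ContinuousLinearEquiv.isOpen
  let e := ((hfs a ha).toOpenPartialHomeomorph f hA hn).restrOpen t ht
  have he_symm : ContDiffOn 𝕜 n e.symm e.target := fun z hz => by
    obtain ⟨hzs, B, hB⟩ := (e.map_target hz).2
    have hBz : HasFDerivAt f (B : E →L[𝕜] F) (e.symm z) :=
      hB ▸ ((hfs _ hzs).differentiableAt hn).hasFDerivAt
    exact (e.contDiffAt_symm hz hBz (hfs _ hzs)).contDiffWithinAt
  exact isLocalDiffeomorphAt_openPartialHomeomorph e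
    (hf.mono fun z hz => hz.2.1).contMDiffOn he_symm.contMDiffOn
    ⟨(hfs a ha).mem_toOpenPartialHomeomorph_source hA hn, ha, A, hA.fderiv.symm⟩

theorem isLocalDiffeomorphAt_of_hasMFDerivAt {M : Type*} [TopologicalSpace M] [ChartedSpace E M]
    [IsManifold 𝓘(𝕜, E) n M] {N : Type*} [TopologicalSpace N] [ChartedSpace F N]
    [IsManifold 𝓘(𝕜, F) n N] {f : M → N} {s : Set M} (hs : IsOpen s)
    (hf : ContMDiffOn 𝓘(𝕜, E) 𝓘(𝕜, F) n f s) (hn : n ≠ 0) {x : M} (hx : x ∈ s) {A : E ≃L[𝕜] F}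
    (hA : HasMFDerivAt 𝓘(𝕜, E) 𝓘(𝕜, F) f x (A : E →L[𝕜] F)) :
    IsLocalDiffeomorphAt 𝓘(𝕜, E) 𝓘(𝕜, F) n f x := by
  let c := chartAt E x
  let d := chartAt F (f x)
  have hc : x ∈ c.source := mem_chart_source E x
  have hd : f x ∈ d.source := mem_chart_source F (f x)
  let t : Set M := s ∩ f ⁻¹' d.source
  have ht : IsOpen t := hf.continuousOn.isOpen_inter_preimage hs d.open_source
  have hchart : ContDiffOn 𝕜 n (d ∘ f ∘ c.symm) (c.target ∩ c.symm ⁻¹' t) :=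
    (contMDiffOn_chart.comp (hf.comp (contMDiffOn_chart_symm.mono inter_subset_left)
      fun z hz => hz.2.1) fun z hz => hz.2.2).contDiffOn
  have hderiv : HasFDerivAt (d ∘ f ∘ c.symm) (A : E →L[𝕜] F) (c x) :=
    hA.2.hasFDerivAt (by simp)
  have hlocal : IsLocalDiffeomorphAt 𝓘(𝕜, E) 𝓘(𝕜, F) n (d ∘ f ∘ c.symm) (c x) :=
    isLocalDiffeomorphAt_of_hasFDerivAt (c.isOpen_inter_preimage_symm ht) hchart hn
      ⟨c.map_source hc, by simpa [c] using ⟨hx, hd⟩⟩ hderiv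
  have hcx : IsLocalDiffeomorphAt 𝓘(𝕜, E) 𝓘(𝕜, E) n c x :=
    isLocalDiffeomorphAt_openPartialHomeomorph c contMDiffOn_chart contMDiffOn_chart_symm hc
  have hdx : IsLocalDiffeomorphAt 𝓘(𝕜, F) 𝓘(𝕜, F) n d.symm ((d ∘ f ∘ c.symm) (c x)) :=
    isLocalDiffeomorphAt_openPartialHomeomorph d.symm contMDiffOn_chart_symm
      (by simpa using contMDiffOn_chart) (by simpa [hc] using d.map_source hd)
  refine isLocalDiffeomorphAt_of_eventuallyEq ((hcx.comp _ _ hlocal).comp _ _ hdx) ?_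
  filter_upwards [c.open_source.mem_nhds hc, ht.mem_nhds ⟨hx, hd⟩] with y hyc hyt
  simp [c.left_inv hyc, d.left_inv hyt.2]

end InverseFunctionTheorem

section IntegralSections

variable {m : ℕ} {M : Type*} [TopologicalSpace M] [ChartedSpace (Euc m) M]
  {F : Type*} [NormedAddCommGroup F] [NormedSpace ℝ F]
  {N : Type*} [TopologicalSpace N] [ChartedSpace F N] {D : TangentDistribution F N}
  {ρ : N → M} {U : Set M} {ψ : M → N} {x : M} {p : N}

theorem IsLocalSection.mdifferentiableAt (hψ : IsLocalSection (m := m) (F := F) ρ U ψ)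
    (hx : x ∈ U) : MDifferentiableAt (𝓡 m) 𝓘(ℝ, F) ψ x :=
  (hψ.smooth.contMDiffAt (hψ.isOpen.mem_nhds hx)).mdifferentiableAt (by simp)

theorem IsLocalSection.mfderiv_apply_mfderiv (hψ : IsLocalSection (m := m) (F := F) ρ U ψ)
    (hx : x ∈ U) (hρ : MDifferentiableAt 𝓘(ℝ, F) (𝓡 m) ρ (ψ x)) (v : TangentSpace (𝓡 m) x) :
    mfderiv 𝓘(ℝ, F) (𝓡 m) ρ (ψ x) (mfderiv (𝓡 m) 𝓘(ℝ, F) ψ x v) = v := by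
  have hcomp := hρ.hasMFDerivAt.comp x (hψ.mdifferentiableAt hx).hasMFDerivAt
  have hid : ρ ∘ ψ =ᶠ[𝓝 x] id :=
    Filter.eventuallyEq_of_mem (hψ.isOpen.mem_nhds hx) hψ.proj
  exact DFunLike.congr_fun
    (hasMFDerivAt_unique hcomp ((hasMFDerivAt_id x).congr_of_eventuallyEq hid)) v

theorem TangentDistribution.IsTransverse.injOn (ht : D.IsTransverse (m := m) ρ) (p : N) :
    InjOn (mfderiv 𝓘(ℝ, F) (𝓡 m) ρ p) (D p) :=
  LinearMap.injOn_of_disjoint_ker le_rfl (ht p)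

theorem TangentDistribution.IsTransverse.isIntegralSection (ht : D.IsTransverse (m := m) ρ)
    (hρ : MDifferentiable 𝓘(ℝ, F) (𝓡 m) ρ) (hψ : IsLocalSection (m := m) (F := F) ρ U ψ)
    (hψD : ∀ x ∈ U, (mfderiv (𝓡 m) 𝓘(ℝ, F) ψ x).range ≤ D (ψ x)) :
    D.IsIntegralSection (m := m) U ψ := fun x hx =>
  le_antisymm (hψD x hx) fun w hw =>
    ⟨mfderiv 𝓘(ℝ, F) (𝓡 m) ρ (ψ x) w, ht.injOn (ψ x) (hψD x hx ⟨_, rfl⟩) hw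
      (hψ.mfderiv_apply_mfderiv hx (hρ (ψ x)) _)⟩

theorem TangentDistribution.IsIntegralSection.map_mfderiv_eq {G : Type*} [NormedAddCommGroup G]
    [NormedSpace ℝ G] {B : Type*} [TopologicalSpace B] [ChartedSpace G B] {r : N → B}
    {D' : TangentDistribution G B} (hψD : D.IsIntegralSection (m := m) U ψ)
    (hrψD' : D'.IsIntegralSection (m := m) U (r ∘ ψ)) (hx : x ∈ U)
    (hψ : MDifferentiableAt (𝓡 m) 𝓘(ℝ, F) ψ x) (hr : MDifferentiableAt 𝓘(ℝ, F) 𝓘(ℝ, G) r (ψ x)) :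
    (D (ψ x)).map (mfderiv 𝓘(ℝ, F) 𝓘(ℝ, G) r (ψ x)).toLinearMap = D' (r (ψ x)) := by
  have hrange := hrψD' x hx
  rw [mfderiv_comp x hr hψ] at hrange
  rw [← hψD x hx]
  exact (LinearMap.range_comp _ _).symm.trans hrange

theorem TangentDistribution.IsIntegrable.exists_isIntegralSection [IsManifold (𝓡 m) ∞ M]
    (hD : D.IsIntegrable m) (hρ : ContMDiff 𝓘(ℝ, F) (𝓡 m) ∞ ρ)
    (ht : D.IsTransverse (m := m) ρ) (p : N) :
    ∃ (U : Set M) (ψ : M → N) (x : M), IsLocalSection (m := m) (F := F) ρ U ψ ∧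
      D.IsIntegralSection (m := m) U ψ ∧ x ∈ U ∧ ψ x = p := by
  obtain ⟨V, f, y, hV, hy, rfl, hf, hfD⟩ := hD p
  have hρ' : MDifferentiable 𝓘(ℝ, F) (𝓡 m) ρ := hρ.mdifferentiable (by simp)
  have hf' : ∀ z ∈ V, MDifferentiableAt (𝓡 m) 𝓘(ℝ, F) f z := fun z hz =>
    (hf.contMDiffAt (hV.mem_nhds hz)).mdifferentiableAt (by simp)
  have hderiv := (hρ' (f y)).hasMFDerivAt.comp y (hf' y hy).hasMFDerivAt
  have hinj : Injective ((mfderiv 𝓘(ℝ, F) (𝓡 m) ρ (f y)).comp (mfderiv (𝓡 m) 𝓘(ℝ, F) f y)) :=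
    fun v w hvw => (hfD y hy).1 <|
      ht.injOn (f y) ((hfD y hy).2.le ⟨v, rfl⟩) ((hfD y hy).2.le ⟨w, rfl⟩) hvw
  obtain ⟨A, hA⟩ := isInvertible_of_injective (V := Euc m) (W := Euc m) hinj rfl
  have hlocal : IsLocalDiffeomorphAt (𝓡 m) (𝓡 m) ∞ (ρ ∘ f) y :=
    isLocalDiffeomorphAt_of_hasMFDerivAt hV (hρ.comp_contMDiffOn hf) (by simp) hy
      (A := A) (hA ▸ hderiv)
  -- An integral manifold `f` becomes a section after reparametrization by the inverse of `ρ ∘ f`.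
  let g := hlocal.localInverse
  have hg : ContMDiffOn (𝓡 m) (𝓡 m) ∞ g g.source := hlocal.localInverse_contMDiffOn
  have hU : IsOpen (g.source ∩ g ⁻¹' V) :=
    hg.continuousOn.isOpen_inter_preimage hlocal.localInverse_open_source hV
  have hgy : g (ρ (f y)) = y := hlocal.localInverse_left_inv hlocal.localInverse_mem_target
  have hfg : IsLocalSection (m := m) (F := F) ρ (g.source ∩ g ⁻¹' V) (f ∘ g) :=
    ⟨hU, hf.comp (hg.mono inter_subset_left) inter_subset_right,
      fun x hx => hlocal.localInverse_right_inv hx.1⟩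
  refine ⟨_, f ∘ g, ρ (f y), hfg, ht.isIntegralSection hρ' hfg fun x hx => ?_,
    ⟨hlocal.localInverse_mem_source, by rwa [mem_preimage, hgy]⟩, congrArg f hgy⟩
  have hgx : MDifferentiableAt (𝓡 m) (𝓡 m) g x :=
    (hg.contMDiffAt (hlocal.localInverse_open_source.mem_nhds hx.1)).mdifferentiableAt (by simp)
  rw [mfderiv_comp x (hf' (g x) hx.2) hgx, comp_apply, ← (hfD (g x) hx.2).2]
  exact LinearMap.range_comp_le_range _ _

theorem VField.exists_smoothOn_univ_apply_eq [FiniteDimensional ℝ F] [IsManifold 𝓘(ℝ, F) ∞ N]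
    [T2Space N] (p : N) (w : TangentSpace 𝓘(ℝ, F) p) :
    ∃ X : VField F N, X.SmoothOn univ ∧ X p = w := by
  obtain ⟨s, hs, hX⟩ := FiberBundle.exists_contMDiffOn_extend (k := ∞) 𝓘(ℝ, F) F w
  obtain ⟨U, hUs, hU, hp⟩ := mem_nhds_iff.1 hs
  obtain ⟨b, hb, -⟩ := (SmoothBumpFunction.nhds_basis_support (I := 𝓘(ℝ, F))
    (hU.mem_nhds hp)).mem_iff.1 Filter.univ_mem
  refine ⟨(b : N → ℝ) • FiberBundle.extend F w, ?_, by simp⟩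
  exact (ContMDiffOn.smul_section_of_tsupport b.contMDiff.contMDiffOn hU hb
    (hX.mono hUs)).contMDiffOn

variable [IsManifold (𝓡 m) ∞ M] [FiniteDimensional ℝ F] [IsManifold 𝓘(ℝ, F) ∞ N] [T2Space N]
  {Ω : DiffForm F N (m + 1)}

theorem TangentDistribution.IsIntegrable.form_cons_eq_zero (hD : D.IsIntegrable m)
    (hρ : ContMDiff 𝓘(ℝ, F) (𝓡 m) ∞ ρ) (ht : D.IsTransverse (m := m) ρ)
    (hΩ : ∀ (U : Set M) (ψ : M → N), IsLocalSection (m := m) (F := F) ρ U ψ →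
      D.IsIntegralSection (m := m) U ψ → SolvesFieldEquation (m := m) Ω U ψ)
    (w : TangentSpace 𝓘(ℝ, F) p) {e : Fin m → TangentSpace 𝓘(ℝ, F) p} (he : ∀ i, e i ∈ D p) :
    Ω p (Fin.cons w e) = 0 := by
  obtain ⟨U, ψ, x, hψ, hψD, hx, rfl⟩ := hD.exists_isIntegralSection hρ ht p
  obtain ⟨X, hX, rfl⟩ := VField.exists_smoothOn_univ_apply_eq (ψ x) w
  choose v hv using fun i => (hψD x hx).ge (he i)
  obtain rfl : (fun i => mfderiv (𝓡 m) 𝓘(ℝ, F) ψ x (v i)) = e := funext hv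
  exact hΩ U ψ hψ hψD X hX x hx v

theorem TangentDistribution.IsIntegrable.contractionVanishes (hD : D.IsIntegrable m)
    (hρ : ContMDiff 𝓘(ℝ, F) (𝓡 m) ∞ ρ) (ht : D.IsTransverse (m := m) ρ)
    (hΩ : ∀ (U : Set M) (ψ : M → N), IsLocalSection (m := m) (F := F) ρ U ψ →
      D.IsIntegralSection (m := m) U ψ → SolvesFieldEquation (m := m) Ω U ψ)
    {X : MVField F N m}
    (hX : ∀ p, X p ∈ LinearMap.range (exteriorPower.map m (D p).subtype)) :
    ContractionVanishes X Ω := fun p w =>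
  alternatingMapLinearEquiv_apply_eq_zero
    (fun _ he => hD.form_cons_eq_zero hρ ht hΩ w he) (hX p)

end IntegralSections

section FrameCoefficients

variable {𝕜 : Type*} [NontriviallyNormedField 𝕜] [CompleteSpace 𝕜]
  {EN : Type*} [NormedAddCommGroup EN] [NormedSpace 𝕜 EN] {HN : Type*} [TopologicalSpace HN]
  {I : ModelWithCorners 𝕜 EN HN} {N : Type*} [TopologicalSpace N] [ChartedSpace HN N]
  {G : Type*} [NormedAddCommGroup G] [NormedSpace 𝕜 G] [FiniteDimensional 𝕜 G]
  {ι : Type*} [Fintype ι] {k : ℕ∞ω} {p₀ : N}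

theorem exists_contMDiffAt_sum_smul_eq {b : ι → N → G} {a : N → G}
    (hb : ∀ j, ContMDiffAt I 𝓘(𝕜, G) k (b j) p₀) (ha : ContMDiffAt I 𝓘(𝕜, G) k a p₀)
    (hli : LinearIndependent 𝕜 fun j => b j p₀) (hι : Fintype.card ι = Module.finrank 𝕜 G) :
    ∃ c : ι → N → 𝕜, (∀ j, ContMDiffAt I 𝓘(𝕜, 𝕜) k (c j) p₀) ∧
      ∀ᶠ p in 𝓝 p₀, ∑ j, c j p • b j p = a p := by
  let L : (ι → G) →L[𝕜] (ι → 𝕜) →L[𝕜] G :=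
    ∑ j, (ContinuousLinearMap.smulRightL 𝕜 (ι → 𝕜) G (ContinuousLinearMap.proj j)).comp
      (ContinuousLinearMap.proj j)
  have hL : ∀ v x, L v x = ∑ j, x j • v j := fun v x => by simp [L]
  let B : N → (ι → 𝕜) →L[𝕜] G := fun p => L fun j => b j p
  have hB : ContMDiffAt I 𝓘(𝕜, (ι → 𝕜) →L[𝕜] G) k B p₀ :=
    L.contDiff.contMDiff.contMDiffAt.comp p₀ (contMDiffAt_pi_space.2 hb)
  have hBinj : Injective (B p₀) := (injective_iff_map_eq_zero _).2 fun x hx =>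
    funext (Fintype.linearIndependent_iff.1 hli x ((hL _ x).symm.trans hx))
  have hBinv : (B p₀).IsInvertible := isInvertible_of_injective hBinj (by simpa using hι)
  have hinverse : ContMDiffAt I 𝓘(𝕜, G →L[𝕜] ι → 𝕜) k (fun p => (B p).inverse) p₀ :=
    hBinv.contDiffAt_map_inverse.contMDiffAt.comp p₀ hB
  have hBnear : ∀ᶠ p in 𝓝 p₀, (B p).IsInvertible := by
    obtain ⟨A, hA⟩ := hBinv
    exact hB.continuousAt (hA ▸ A.nhds)
  refine ⟨fun j p => (B p).inverse (a p) j, contMDiffAt_pi_space.1 (hinverse.clm_apply ha), ?_⟩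
  filter_upwards [hBnear] with p hp
  rw [← hL]
  exact hp.self_apply_inverse (a p)

variable {EB : Type*} [NormedAddCommGroup EB] [NormedSpace 𝕜 EB] {HB : Type*}
  [TopologicalSpace HB] {J : ModelWithCorners 𝕜 EB HB} {B : Type*} [TopologicalSpace B]
  [ChartedSpace HB B] {V : B → Type*} [TopologicalSpace (Bundle.TotalSpace G V)]
  [∀ x, AddCommGroup (V x)] [∀ x, Module 𝕜 (V x)] [∀ x, TopologicalSpace (V x)]
  [FiberBundle G V] [VectorBundle 𝕜 G V]

theorem exists_contMDiffAt_sum_smul_section_eq {f : N → B} {b : ι → ∀ p, V (f p)}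
    {a : ∀ p, V (f p)}
    (hb : ∀ j, ContMDiffAt I (J.prod 𝓘(𝕜, G)) k
      (fun p => (⟨f p, b j p⟩ : Bundle.TotalSpace G V)) p₀)
    (ha : ContMDiffAt I (J.prod 𝓘(𝕜, G)) k (fun p => (⟨f p, a p⟩ : Bundle.TotalSpace G V)) p₀)
    (hli : LinearIndependent 𝕜 fun j => b j p₀) (hι : Fintype.card ι = Module.finrank 𝕜 G) :
    ∃ c : ι → N → 𝕜, (∀ j, ContMDiffAt I 𝓘(𝕜, 𝕜) k (c j) p₀) ∧
      ∀ᶠ p in 𝓝 p₀, ∑ j, c j p • b j p = a p := by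
  let e := trivializationAt G V (f p₀)
  have hf : ContMDiffAt I J k f p₀ := (Bundle.contMDiffAt_totalSpace.1 ha).1
  have hp₀ : f p₀ ∈ e.baseSet := FiberBundle.mem_baseSet_trivializationAt G V (f p₀)
  obtain ⟨c, hc, hca⟩ := exists_contMDiffAt_sum_smul_eq
    (fun j => (Bundle.contMDiffAt_totalSpace.1 (hb j)).2) (Bundle.contMDiffAt_totalSpace.1 ha).2
    (hli.map' (e.continuousLinearEquivAt 𝕜 (f p₀) hp₀).toLinearEquiv.toLinearMap
      (LinearEquiv.ker _)) hι
  refine ⟨c, hc, ?_⟩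
  filter_upwards [hca, hf.continuousAt (e.open_baseSet.mem_nhds hp₀)] with p hcap hp
  apply (e.continuousLinearEquivAt 𝕜 (f p) hp).injective
  rw [map_sum]
  simp only [map_smul]
  exact hcap

end FrameCoefficients

section HorizontalLift

variable {m : ℕ} {M : Type*} [TopologicalSpace M] [ChartedSpace (Euc m) M]
  {F : Type*} [NormedAddCommGroup F] [NormedSpace ℝ F]
  {N : Type*} [TopologicalSpace N] [ChartedSpace F N] [IsManifold 𝓘(ℝ, F) ∞ N]
  {D : TangentDistribution F N} {ρ : N → M}

namespace TangentDistribution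

theorem HasRank.finrank_eq (hD : D.HasRank m) (p : N) : Module.finrank ℝ (D p) = m := by
  obtain ⟨U, X, -, hp, -, hX⟩ := hD p
  obtain ⟨hli, hspan⟩ := hX p hp
  rw [hspan, finrank_span_eq_card hli, Fintype.card_fin]

theorem HasRank.finiteDimensional (hD : D.HasRank m) (p : N) : FiniteDimensional ℝ (D p) := by
  obtain ⟨U, X, -, hp, -, hX⟩ := hD p
  rw [(hX p hp).2]
  exact FiniteDimensional.span_of_finite ℝ (finite_range _)

/-- The isomorphism of `D p` with the tangent space of the base induced by `ρ`, for a transverse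
distribution whose rank is the dimension of the base. -/
def mfderivEquiv (hD : D.HasRank m) (ht : D.IsTransverse (m := m) ρ) (p : N) :
    D p ≃ₗ[ℝ] TangentSpace (𝓡 m) (ρ p) :=
  have := hD.finiteDimensional p
  have : FiniteDimensional ℝ (TangentSpace (𝓡 m) (ρ p)) :=
    inferInstanceAs (FiniteDimensional ℝ (Euc m))
  LinearEquiv.ofInjectiveOfFinrankEq
    ((mfderiv 𝓘(ℝ, F) (𝓡 m) ρ p).toLinearMap.domRestrict (D p))
    (LinearMap.injective_domRestrict_iff.2 (ht p))
    ((hD.finrank_eq p).trans (finrank_euclideanSpace_fin (𝕜 := ℝ) (n := m)).symm)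

/-- The horizontal lift of tangent vectors of the base to the distribution `D`, which is viewed as
the horizontal subbundle of an Ehresmann connection on `ρ`. -/
def horizontalLift (hD : D.HasRank m) (ht : D.IsTransverse (m := m) ρ) (p : N) :
    TangentSpace (𝓡 m) (ρ p) →ₗ[ℝ] TangentSpace 𝓘(ℝ, F) p :=
  (D p).subtype ∘ₗ (mfderivEquiv hD ht p).symm.toLinearMap

variable (hD : D.HasRank m) (ht : D.IsTransverse (m := m) ρ)

theorem horizontalLift_mem (p : N) (v : TangentSpace (𝓡 m) (ρ p)) :
    horizontalLift hD ht p v ∈ D p :=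
  ((mfderivEquiv hD ht p).symm v).2

theorem mfderiv_horizontalLift (p : N) (v : TangentSpace (𝓡 m) (ρ p)) :
    mfderiv 𝓘(ℝ, F) (𝓡 m) ρ p (horizontalLift hD ht p v) = v :=
  (mfderivEquiv hD ht p).apply_symm_apply v

theorem horizontalLift_mfderiv {p : N} {w : TangentSpace 𝓘(ℝ, F) p} (hw : w ∈ D p) :
    horizontalLift hD ht p (mfderiv 𝓘(ℝ, F) (𝓡 m) ρ p w) = w :=
  ht.injOn p (horizontalLift_mem hD ht p _) hw (mfderiv_horizontalLift hD ht p _)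

theorem horizontalLift_injective (p : N) : Injective (horizontalLift hD ht p) :=
  LeftInverse.injective (mfderiv_horizontalLift hD ht p)

theorem contMDiffAt_horizontalLift [IsManifold (𝓡 m) ∞ M] (hρ : ContMDiff 𝓘(ℝ, F) (𝓡 m) ∞ ρ)
    {a : ∀ p, TangentSpace (𝓡 m) (ρ p)} {p₀ : N}
    (ha : ContMDiffAt 𝓘(ℝ, F) (𝓡 m).tangent ∞ (fun p => (⟨ρ p, a p⟩ : TangentBundle (𝓡 m) M)) p₀) :
    ContMDiffAt 𝓘(ℝ, F) 𝓘(ℝ, F).tangent ∞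
      (fun p => (⟨p, horizontalLift hD ht p (a p)⟩ : TangentBundle 𝓘(ℝ, F) N)) p₀ := by
  obtain ⟨U, X, hU, hp₀, hX, hXD⟩ := hD p₀
  have hX₀ : ∀ j, ContMDiffAt 𝓘(ℝ, F) 𝓘(ℝ, F).tangent ∞
      (fun p => (⟨p, X j p⟩ : TangentBundle 𝓘(ℝ, F) N)) p₀ := fun j =>
    (hX j).contMDiffAt (hU.mem_nhds hp₀)
  have hdX : ∀ j, ContMDiffAt 𝓘(ℝ, F) (𝓡 m).tangent ∞
      (fun p => (⟨ρ p, mfderiv 𝓘(ℝ, F) (𝓡 m) ρ p (X j p)⟩ : TangentBundle (𝓡 m) M)) p₀ :=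
    fun j => (hρ.contMDiff_tangentMap (by simp)).contMDiffAt.comp p₀ (hX₀ j)
  have hli : LinearIndependent ℝ fun j => mfderiv 𝓘(ℝ, F) (𝓡 m) ρ p₀ (X j p₀) :=
    (hXD p₀ hp₀).1.map (f := (mfderiv 𝓘(ℝ, F) (𝓡 m) ρ p₀).toLinearMap)
      ((hXD p₀ hp₀).2 ▸ ht p₀)
  obtain ⟨c, hc, hca⟩ := exists_contMDiffAt_sum_smul_section_eq hdX ha hli (by simp)
  have hsum : ContMDiffAt 𝓘(ℝ, F) 𝓘(ℝ, F).tangent ∞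
      (fun p => (⟨p, ∑ j, c j p • X j p⟩ : TangentBundle 𝓘(ℝ, F) N)) p₀ :=
    ContMDiffAt.sum_section fun j _ => (hc j).smul_section (hX₀ j)
  refine hsum.congr_of_eventuallyEq ?_
  filter_upwards [hca, hU.mem_nhds hp₀] with p hcap hp
  have hmem : ∑ j, c j p • X j p ∈ D p := by
    rw [(hXD p hp).2]
    exact sum_mem fun j _ => Submodule.smul_mem _ _ (Submodule.subset_span ⟨j, rfl⟩)
  rw [← horizontalLift_mfderiv hD ht hmem, map_sum]
  simp only [map_smul, hcap]

end TangentDistribution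

variable {G : Type*} [NormedAddCommGroup G] [NormedSpace ℝ G] {B : Type*} [TopologicalSpace B]
  [ChartedSpace G B] {π : B → M} {r : N → B} {k : ℕ}

/-- The lift of a multivector field `X` on `B` along `r : N → B`: each factor of `X` is projected
to `M` by `Tπ` and lifted horizontally to `D`. -/
def MVField.horizontalLift (hD : D.HasRank m) (ht : D.IsTransverse (m := m) (π ∘ r))
    (X : MVField G B k) : MVField F N k := fun p =>
  exteriorPower.map k (TangentDistribution.horizontalLift hD ht p ∘ₗ
    (mfderiv 𝓘(ℝ, G) (𝓡 m) π (r p)).toLinearMap) (X (r p))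

variable {D' : TangentDistribution G B}

theorem TangentDistribution.mfderiv_horizontalLift_mfderiv (hD : D.HasRank m)
    (ht : D.IsTransverse (m := m) (π ∘ r)) (ht' : D'.IsTransverse (m := m) π) {p : N}
    (hπ : MDifferentiableAt 𝓘(ℝ, G) (𝓡 m) π (r p))
    (hr : MDifferentiableAt 𝓘(ℝ, F) 𝓘(ℝ, G) r p)
    (hmap : (D p).map (mfderiv 𝓘(ℝ, F) 𝓘(ℝ, G) r p).toLinearMap ≤ D' (r p))
    {v : TangentSpace 𝓘(ℝ, G) (r p)} (hv : v ∈ D' (r p)) :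
    mfderiv 𝓘(ℝ, F) 𝓘(ℝ, G) r p
      (horizontalLift hD ht p (mfderiv 𝓘(ℝ, G) (𝓡 m) π (r p) v)) = v := by
  refine ht'.injOn (r p) (hmap ⟨_, horizontalLift_mem hD ht p _, rfl⟩) hv ?_
  exact (mfderiv_comp_apply p hπ hr _).symm.trans (mfderiv_horizontalLift hD ht p _)

variable [IsManifold 𝓘(ℝ, G) ∞ B]

theorem MVField.IsAssociated.map_horizontalLift {X : MVField G B m} (hX : X.IsAssociated D')
    (hD : D.HasRank m) (ht : D.IsTransverse (m := m) (π ∘ r)) (ht' : D'.IsTransverse (m := m) π)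
    {p : N} (hπ : MDifferentiableAt 𝓘(ℝ, G) (𝓡 m) π (r p))
    (hr : MDifferentiableAt 𝓘(ℝ, F) 𝓘(ℝ, G) r p)
    (hmap : (D p).map (mfderiv 𝓘(ℝ, F) 𝓘(ℝ, G) r p).toLinearMap ≤ D' (r p)) :
    exteriorPower.map m (mfderiv 𝓘(ℝ, F) 𝓘(ℝ, G) r p).toLinearMap (X.horizontalLift hD ht p) =
      X (r p) := by
  rw [MVField.horizontalLift, ← LinearMap.comp_apply, ← exteriorPower.map_comp]
  exact exteriorPower_map_eq_self (fun v hv =>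
    TangentDistribution.mfderiv_horizontalLift_mfderiv hD ht ht' hπ hr hmap hv) (hX.mem (r p))

variable [IsManifold (𝓡 m) ∞ M] {X : MVField G B k}

theorem MVField.IsLocallyDecomposable.horizontalLift (hX : X.IsLocallyDecomposable)
    (hπ : ContMDiff 𝓘(ℝ, G) (𝓡 m) ∞ π) (hr : ContMDiff 𝓘(ℝ, F) 𝓘(ℝ, G) ∞ r)
    (hD : D.HasRank m) (ht : D.IsTransverse (m := m) (π ∘ r)) :
    (X.horizontalLift hD ht).IsLocallyDecomposable := fun p₀ => by
  obtain ⟨U, Y, hU, hp₀, hY, hXY⟩ := hX (r p₀)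
  refine ⟨r ⁻¹' U, fun i p => TangentDistribution.horizontalLift hD ht p
    (mfderiv 𝓘(ℝ, G) (𝓡 m) π (r p) (Y i (r p))), hU.preimage hr.continuous, hp₀,
    fun i p hp => ?_, fun p hp => ?_⟩
  · have hYr : ContMDiffAt 𝓘(ℝ, F) 𝓘(ℝ, G).tangent ∞
        (fun q => (⟨r q, Y i (r q)⟩ : TangentBundle 𝓘(ℝ, G) B)) p :=
      ((hY i).contMDiffAt (hU.mem_nhds hp)).comp p hr.contMDiffAt
    exact (TangentDistribution.contMDiffAt_horizontalLift hD ht (hπ.comp hr)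
      ((hπ.contMDiff_tangentMap (by simp)).contMDiffAt.comp p hYr)).contMDiffWithinAt
  · rw [MVField.horizontalLift, hXY _ hp, exteriorPower.map_apply_ιMulti]
    rfl

theorem MVField.IsAssociated.horizontalLift (hX : X.IsAssociated D')
    (ht' : D'.IsTransverse (m := m) π)
    (hπ : ContMDiff 𝓘(ℝ, G) (𝓡 m) ∞ π) (hr : ContMDiff 𝓘(ℝ, F) 𝓘(ℝ, G) ∞ r)
    (hD : D.HasRank m) (ht : D.IsTransverse (m := m) (π ∘ r)) :
    (X.horizontalLift hD ht).IsAssociated D where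
  ne_zero p := by
    refine exteriorPower_map_ne_zero ?_ (hX.mem (r p)) (hX.ne_zero (r p))
    rw [LinearMap.ker_comp_of_ker_eq_bot _
      (LinearMap.ker_eq_bot.2 (TangentDistribution.horizontalLift_injective hD ht p))]
    exact ht' (r p)
  locallyDecomposable := hX.locallyDecomposable.horizontalLift hπ hr hD ht
  mem p := exteriorPower_map_mem_range
    (TangentDistribution.horizontalLift hD ht p ∘ₗ
      (mfderiv 𝓘(ℝ, G) (𝓡 m) π (r p)).toLinearMap)
    (fun _ => TangentDistribution.horizontalLift_mem hD ht p _) (X (r p))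

end HorizontalLift

theorem GenHJCondition.map_mfderiv_eq {m n : ℕ} {M E : Type*}
    [TopologicalSpace M] [ChartedSpace (Euc m) M] [IsManifold (𝓡 m) ∞ M]
    [TopologicalSpace E] [ChartedSpace (Euc (m + n)) E] {π : E → M}
    {F P : Type*} [NormedAddCommGroup F] [NormedSpace ℝ F] [TopologicalSpace P]
    [ChartedSpace F P] {r : P → E} {σ : E → P} {D : TangentDistribution (Euc (m + n)) E}
    {DP : TangentDistribution F P} (h : GenHJCondition π D DP σ)
    (hD : D.IsIntegrable m) (hDt : D.IsTransverse (m := m) π)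
    (hπ : ContMDiff (𝓡 (m + n)) (𝓡 m) ∞ π) (hr : MDifferentiable 𝓘(ℝ, F) (𝓡 (m + n)) r)
    (hσ : MDifferentiable (𝓡 (m + n)) 𝓘(ℝ, F) σ) (hrσ : ∀ u, r (σ u) = u) (u : E) :
    (DP (σ u)).map (mfderiv 𝓘(ℝ, F) (𝓡 (m + n)) r (σ u)).toLinearMap = D (r (σ u)) := by
  obtain ⟨U, γ, x, hγ, hγD, hx, rfl⟩ := hD.exists_isIntegralSection hπ hDt u
  have hrσγ : r ∘ σ ∘ γ = γ := funext fun y => hrσ (γ y)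
  exact (h U γ hγ hγD).map_mfderiv_eq (r := r) (hrσγ.symm ▸ hγD) hx
    ((hσ (γ x)).comp x (hγ.mdifferentiableAt hx)) (hr (σ (γ x)))

namespace FibreCharts

variable {B : Type*} [TopologicalSpace B] {V W : Type*} [NormedAddCommGroup V]
  [NormedSpace ℝ V] [NormedAddCommGroup W] [NormedSpace ℝ W] {Z : B → Type*}
  (c : FibreCharts V W Z)

theorem contMDiff_proj {G : Type*} [NormedAddCommGroup G] [NormedSpace ℝ G] [ChartedSpace G B]
    (hc : ∀ i, ContMDiffOn 𝓘(ℝ, V) 𝓘(ℝ, G) ∞ (c.base i).symm (c.base i).target) :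
    let _ := c.core.toTopologicalSpace
    let _ := c.core.toChartedSpace
    ContMDiff 𝓘(ℝ, V × W) 𝓘(ℝ, G) ∞ (Bundle.TotalSpace.proj : Bundle.TotalSpace W Z → B) := by
  intro _ _
  have _ : IsManifold 𝓘(ℝ, V × W) ∞ (Bundle.TotalSpace W Z) := c.isManifold
  intro p
  have hs : (chartAt (V × W) p).source ∈ 𝓝 p :=
    (chartAt (V × W) p).open_source.mem_nhds (mem_chart_source _ p)
  have hfst : ∀ q ∈ (chartAt (V × W) p).source,
      (chartAt (V × W) p q).1 = c.base p.proj q.proj := by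
    rintro ⟨u, a⟩ hq
    exact congrArg Prod.fst (c.chart_apply p.proj a hq)
  have hbase : ContMDiffOn 𝓘(ℝ, V × W) 𝓘(ℝ, V) ∞ (fun q => (chartAt (V × W) p q).1)
      (chartAt (V × W) p).source :=
    contDiff_fst.contMDiff.comp_contMDiffOn contMDiffOn_chart
  refine (((hc p.proj).comp hbase fun q hq => ?_).congr fun q hq => ?_).contMDiffAt hs
  · rw [mem_preimage, hfst q hq]
    exact (c.base p.proj).map_source hq
  · rw [comp_apply, hfst q hq]
    exact ((c.base p.proj).left_inv hq).symm

theorem t2Space [T2Space B] :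
    let _ := c.core.toTopologicalSpace
    Continuous (Bundle.TotalSpace.proj : Bundle.TotalSpace W Z → B) →
      T2Space (Bundle.TotalSpace W Z) := by
  intro _ hproj
  let _ := c.core.toChartedSpace
  refine ⟨fun p q hpq => ?_⟩
  by_cases h : p.proj = q.proj
  · have hp := mem_chart_source (V × W) p
    have hq : q ∈ (chartAt (V × W) p).source := by
      change q.proj ∈ (c.base p.proj).source
      exact h ▸ c.mem_base p.proj
    obtain ⟨s, t, hs, ht, hps, hqt, hst⟩ :=
      t2_separation ((chartAt (V × W) p).injOn.ne hp hq hpq)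
    exact ⟨_, _, (chartAt (V × W) p).isOpen_inter_preimage hs,
      (chartAt (V × W) p).isOpen_inter_preimage ht, ⟨hp, hps⟩, ⟨hq, hqt⟩,
      (hst.preimage _).mono inter_subset_right inter_subset_right⟩
  · obtain ⟨s, t, hs, ht, hps, hqt, hst⟩ := t2_separation h
    exact ⟨_, _, hs.preimage hproj, ht.preimage hproj, hps, hqt, hst.preimage _⟩

end FibreCharts

section Projections

variable {m n : ℕ} {M E : Type*} [TopologicalSpace M] [ChartedSpace (Euc m) M]
  [TopologicalSpace E] [ChartedSpace (Euc (m + n)) E] {π : E → M} [hπ : IsFibredManifold m n π]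

theorem IsFibredManifold.contMDiff : ContMDiff (𝓡 (m + n)) (𝓡 m) ∞ π := fun u =>
  (hπ.submersion u).contMDiffAt

theorem Jet.contMDiff_toE :
    ContMDiff 𝓘(ℝ, JetSpace m n) (𝓡 (m + n)) ∞ (Jet.toE : Jet m n π → E) :=
  (jetCharts m n π).contMDiff_proj (contMDiffOn_adapted_symm m n π)

theorem Dual.contMDiff_toE :
    ContMDiff 𝓘(ℝ, DualSpace m n) (𝓡 (m + n)) ∞ (Dual.toE : Dual m n π → E) :=
  (dualCharts m n π).contMDiff_proj (contMDiffOn_adapted_symm m n π)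

instance [T2Space E] : T2Space (Jet m n π) :=
  (jetCharts m n π).t2Space Jet.contMDiff_toE.continuous

instance [T2Space E] : T2Space (Dual m n π) :=
  (dualCharts m n π).t2Space Dual.contMDiff_toE.continuous

end Projections

end FieldHJ

end

/- The conclusions are stated at `r (σ u)`, which equals `u` only propositionally, because
`mfderiv r (σ u)` takes its values in the tangent space at `r (σ u)`. -/
theorem mainTheorem8_general {m n : ℕ} {M E : Type*}
    [TopologicalSpace M] [ChartedSpace (Euc m) M] [IsManifold (𝓡 m) ∞ M]
    [TopologicalSpace E] [ChartedSpace (Euc (m + n)) E] [IsManifold (𝓡 (m + n)) ∞ E]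
    {F P : Type*} [NormedAddCommGroup F] [NormedSpace ℝ F] [FiniteDimensional ℝ F]
    [TopologicalSpace P] [ChartedSpace F P] [IsManifold 𝓘(ℝ, F) ∞ P] [T2Space P]
    {π : E → M} {r : P → E} {σ : E → P}
    {D : TangentDistribution (Euc (m + n)) E} {DP : TangentDistribution F P}
    {Ω : DiffForm F P (m + 1)}
    (hπ : ContMDiff (𝓡 (m + n)) (𝓡 m) ∞ π)
    (hD : D.IsIntegrable m) (hDt : D.IsTransverse (m := m) π)
    (hr : ContMDiff 𝓘(ℝ, F) (𝓡 (m + n)) ∞ r)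
    (hDP : DP.HasRank m) (hDPi : DP.IsIntegrable m) (hDPt : DP.IsTransverse (m := m) (π ∘ r))
    (hΩ : ∀ (U : Set M) (ψ : M → P), IsLocalSection (m := m) (F := F) (π ∘ r) U ψ →
      DP.IsIntegralSection (m := m) U ψ → SolvesFieldEquation (m := m) Ω U ψ)
    (hσ : ContMDiff (𝓡 (m + n)) 𝓘(ℝ, F) ∞ σ) (hrσ : ∀ u, r (σ u) = u)
    (h : GenHJCondition π D DP σ) :
    (∀ X : MVField (Euc (m + n)) E m, X.IsAssociated D →
      ∃ XP : MVField F P m, XP.IsAssociated DP ∧ ContractionVanishes XP Ω ∧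
        ∀ u, X (r (σ u)) = exteriorPower.map m
          (mfderiv 𝓘(ℝ, F) (𝓡 (m + n)) r (σ u)).toLinearMap (XP (σ u))) ∧
    ∀ u, D (r (σ u)) =
      (DP (σ u)).map (mfderiv 𝓘(ℝ, F) (𝓡 (m + n)) r (σ u)).toLinearMap := by
  have hπ' : MDifferentiable (𝓡 (m + n)) (𝓡 m) π := hπ.mdifferentiable (by simp)
  have hr' : MDifferentiable 𝓘(ℝ, F) (𝓡 (m + n)) r := hr.mdifferentiable (by simp)
  have hmap : ∀ u, (DP (σ u)).map (mfderiv 𝓘(ℝ, F) (𝓡 (m + n)) r (σ u)).toLinearMap =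
      D (r (σ u)) :=
    h.map_mfderiv_eq hD hDt hπ hr' (hσ.mdifferentiable (by simp)) hrσ
  refine ⟨fun X hX => ?_, fun u => (hmap u).symm⟩
  have hXP : (X.horizontalLift hDP hDPt).IsAssociated DP :=
    hX.horizontalLift hDt hπ hr hDP hDPt
  exact ⟨X.horizontalLift hDP hDPt, hXP, hDPi.contractionVanishes (hπ.comp hr) hDPt hΩ hXP.mem,
    fun u => (hX.map_horizontalLift hDP hDPt hDt (hπ' _) (hr' _) (hmap u).le).symm⟩

theorem mainTheorem8 {m n : ℕ} {M E : Type*}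
    [TopologicalSpace M] [ChartedSpace (EuclideanSpace ℝ (Fin m)) M] [IsManifold (𝓡 m) ∞ M]
    [T2Space M] [SecondCountableTopology M]
    [TopologicalSpace E] [ChartedSpace (EuclideanSpace ℝ (Fin (m + n))) E]
    [IsManifold (𝓡 (m + n)) ∞ E] [T2Space E] [SecondCountableTopology E]
    (π : E → M) [IsFibredManifold m n π]
    (η : DiffForm (Euc m) M m) (hη : IsVolumeForm η)
    (D : TangentDistribution (Euc (m + n)) E)
    (hD : D.HasRank m) (hDint : D.IsIntegrable m) (hDtrans : D.IsTransverse (m := m) π) :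
    (∀ (L : Jet m n π → ℝ)
      (DL : TangentDistribution (JetSpace m n) (Jet m n π))
      (Ψ : ∀ u, JetFibre m n π u),
      ContMDiff 𝓘(ℝ, JetSpace m n) 𝓘(ℝ, ℝ) ∞ L →
      IsLagrangianSolution η L DL →
      ContMDiff (𝓡 (m + n)) 𝓘(ℝ, JetSpace m n) ∞ (fun u => Jet.mk u (Ψ u)) →
      GenHJCondition π D DL (fun u => Jet.mk u (Ψ u)) →
      (∀ X : MVField (Euc (m + n)) E m, X.IsAssociated D →
        ∃ XL : MVField (JetSpace m n) (Jet m n π) m,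
          XL.IsAssociated DL ∧ ContractionVanishes XL (cartanMultisymplecticForm η L) ∧
          ∀ u, X u = exteriorPower.map m
            (mfderiv 𝓘(ℝ, JetSpace m n) (𝓡 (m + n)) Jet.toE
              (Jet.mk u (Ψ u))).toLinearMap (XL (Jet.mk u (Ψ u)))) ∧
      ∀ u, D u = (DL (Jet.mk u (Ψ u))).map
        (mfderiv 𝓘(ℝ, JetSpace m n) (𝓡 (m + n)) Jet.toE
          (Jet.mk u (Ψ u))).toLinearMap) ∧
    (∀ (h : Dual m n π → ExtDual m n π)
      (Dh : TangentDistribution (DualSpace m n) (Dual m n π))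
      (s : ∀ u, DualFibre m n π u),
      IsHamiltonianSection h →
      IsHamiltonianSolution h Dh →
      ContMDiff (𝓡 (m + n)) 𝓘(ℝ, DualSpace m n) ∞ (fun u => Dual.mk u (s u)) →
      GenHJCondition π D Dh (fun u => Dual.mk u (s u)) →
      (∀ X : MVField (Euc (m + n)) E m, X.IsAssociated D →
        ∃ Xh : MVField (DualSpace m n) (Dual m n π) m,
          Xh.IsAssociated Dh ∧ ContractionVanishes Xh (hamiltonCartanMultisymplecticForm h) ∧
          ∀ u, X u = exteriorPower.map m
            (mfderiv 𝓘(ℝ, DualSpace m n) (𝓡 (m + n)) Dual.toE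
              (Dual.mk u (s u))).toLinearMap (Xh (Dual.mk u (s u)))) ∧
      ∀ u, D u = (Dh (Dual.mk u (s u))).map
        (mfderiv 𝓘(ℝ, DualSpace m n) (𝓡 (m + n)) Dual.toE
          (Dual.mk u (s u))).toLinearMap) := by
  refine ⟨fun L DL Ψ _ hDL hΨ h => ?_, fun H Dh s _ hDh hs h => ?_⟩
  · exact mainTheorem8_general IsFibredManifold.contMDiff hDint hDtrans Jet.contMDiff_toE
      hDL.hasRank hDL.integrable hDL.transverse
      (fun U ψ hψ hψD => (hDL.sections U ψ hψ hψD).choose_spec.2.2) hΨ (fun _ => rfl) h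
  · exact mainTheorem8_general IsFibredManifold.contMDiff hDint hDtrans Dual.contMDiff_toE
      hDh.hasRank hDh.integrable hDh.transverse hDh.sections hs (fun _ => rfl) h
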